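/- Computation is on a randomized unit-cost real RAM: natural-number registers for counting and addressing (constants, addition, truncated subtraction), real registers (rational constants, conversion of a natural number, $+,-,\times,/$, square root), indexed real arrays, comparisons, and fair coin flips; each operation, memory access, test and flip costs one step, and divisions by $0$ and square roots of negative numbers return $0$. There are an algorithm (one finite program for all inputs), an absolute constant $C>0$ and polynomials $p,q$ such that the following holds. Let $m\ge 1$, let $x_1,\dots,x_m$ be points in the unit ball $B$ of a real Hilbert space, and let $\gamma>0$, $H\ge 0$ and $\delta\in(0,1)$. Suppose that the algorithm receives $\gamma,H,\delta$ together with the points, given either as vectors in $\mathbb{R}^d$ (when the Hilbert space is $\mathbb{R}^d$) or as the kernel matrix $K\in\mathbb{R}^{m\times m}$, $K_{i,j}=\langle x_i,x_j\rangle$. Then it outputs points $\bar x_1,\dots,\bar x_m\in\mathbb{R}^k$, where $k$ does not depend on the coin flips, such that: 1. $k\le\left\lceil C\,\dfrac{(H+1)\ln(m/\delta)}{\gamma^2}\right\rceil$. 2. For every labelling $L:\{1,\dots,m\}\to\{-1,1\}$ (not given to the algorithm) for which there is a $w^*\in B$ with $$\sum_{i=1}^m\max\bigl(0,\gamma-L(i)\langle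 w^*,x_i\rangle\bigr)^2\le H,$$ with probability at least $1-\delta$ over the coin flips of the algorithm, $\|\bar x_i\|\le 1$ for all $i$ and there is a $w\in\mathbb{R}^k$ with $\|w\|\le 1$ and $$L(i)\langle w,\bar x_i\rangle\ \ge\ \frac{\gamma}{2+2\sqrt H}\qquad\text{for all } i.$$ 3. For every outcome of the coin flips the algorithm halts after at most $p(d,m,1/\gamma,\ln(1/\delta))$ steps if the input is given as vectors in $\mathbb{R}^d$, and after at most $q(m,1/\gamma,\ln(1/\delta))$ steps if it is given as a kernel matrix. -/

import Mathlib

open MeasureTheory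

noncomputable section

namespace RealRAM

/-! A randomized real random access machine with unit costs. It has natural-number registers (used
for counting and addressing), real registers, and a real memory consisting of two-dimensional
arrays. Programs are finite, and every elementary operation, memory access, coin flip and test
costs one step. -/

/-- Elementary instructions. In each of them the first argument is the target register
(for `store`, the last argument is the register whose content is stored). -/
inductive Instr where
  | natConst (x n : ℕ)
  | natAdd (x y z : ℕ)
  | natSub (x y z : ℕ)
  | realConst (r : ℕ) (q : ℚ)
  | realOfNat (r x : ℕ)
  | realAdd (r s t : ℕ)
  | realSub (r s t : ℕ)
  | realMul (r s t : ℕ)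
  | realDiv (r s t : ℕ)
  | realSqrt (r s : ℕ)
  | load (r a x y : ℕ)
  | store (a x y r : ℕ)
  | flip (r : ℕ)

/-- Tests: comparison of two natural-number registers or of two real registers. -/
inductive Test where
  | natLt (x y : ℕ)
  | realLt (r s : ℕ)
  | realLe (r s : ℕ)

/-- Programs. -/
inductive Program where
  | skip
  | instr (i : Instr)
  | seq (p q : Program)
  | ite (c : Test) (p q : Program)
  | while (c : Test) (p : Program)

/-- Machine states: `mem a i j` is the entry `(i, j)` of array number `a`, and `flips` counts the
coins flipped so far. -/
structure State where
  nat : ℕ → ℕ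
  real : ℕ → ℝ
  mem : ℕ → ℕ → ℕ → ℝ
  flips : ℕ

def State.setNat (s : State) (x n : ℕ) : State :=
  { s with nat := Function.update s.nat x n }

def State.setReal (s : State) (r : ℕ) (v : ℝ) : State :=
  { s with real := Function.update s.real r v }

def State.setMem (s : State) (a i j : ℕ) (v : ℝ) : State :=
  { s with mem := fun a' i' j' => if a' = a ∧ i' = i ∧ j' = j then v else s.mem a' i' j' }

/-- The effect of an instruction, where `ω` is the sequence of coin outcomes. A flip writes a
sign `1` or `-1`. Subtraction of natural numbers is truncated. -/
def Instr.run (ω : ℕ → Bool) (s : State) : Instr → State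
  | .natConst x n => s.setNat x n
  | .natAdd x y z => s.setNat x (s.nat y + s.nat z)
  | .natSub x y z => s.setNat x (s.nat y - s.nat z)
  | .realConst r q => s.setReal r (q : ℝ)
  | .realOfNat r x => s.setReal r (s.nat x : ℝ)
  | .realAdd r u v => s.setReal r (s.real u + s.real v)
  | .realSub r u v => s.setReal r (s.real u - s.real v)
  | .realMul r u v => s.setReal r (s.real u * s.real v)
  | .realDiv r u v => s.setReal r (s.real u / s.real v)
  | .realSqrt r u => s.setReal r (Real.sqrt (s.real u))
  | .load r a x y => s.setReal r (s.mem a (s.nat x) (s.nat y))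
  | .store a x y r => s.setMem a (s.nat x) (s.nat y) (s.real r)
  | .flip r => { s.setReal r (if ω s.flips then 1 else -1) with flips := s.flips + 1 }

def Test.Holds (s : State) : Test → Prop
  | .natLt x y => s.nat x < s.nat y
  | .realLt r u => s.real r < s.real u
  | .realLe r u => s.real r ≤ s.real u

/-- `Exec ω p s s' t`: with coin outcomes `ω`, the program `p` started in state `s` halts in
state `s'` after exactly `t` steps. -/
inductive Exec (ω : ℕ → Bool) : Program → State → State → ℕ → Prop where
  | skip (s : State) : Exec ω .skip s s 0
  | instr (i : Instr) (s : State) : Exec ω (.instr i) s (i.run ω s) 1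
  | seq {p q : Program} {s s' s'' : State} {t u : ℕ} :
      Exec ω p s s' t → Exec ω q s' s'' u → Exec ω (.seq p q) s s'' (t + u)
  | ite_true {c : Test} {p q : Program} {s s' : State} {t : ℕ} :
      c.Holds s → Exec ω p s s' t → Exec ω (.ite c p q) s s' (t + 1)
  | ite_false {c : Test} {p q : Program} {s s' : State} {t : ℕ} :
      ¬ c.Holds s → Exec ω q s s' t → Exec ω (.ite c p q) s s' (t + 1)
  | while_true {c : Test} {p : Program} {s s' s'' : State} {t u : ℕ} :
      c.Holds s → Exec ω p s s' t → Exec ω (.while c p) s' s'' u →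
        Exec ω (.while c p) s s'' (t + u + 1)
  | while_false {c : Test} {p : Program} {s : State} :
      ¬ c.Holds s → Exec ω (.while c p) s s 1

/-- The law of an infinite sequence of independent fair coins. -/
def coins : Measure (ℕ → Bool) :=
  Measure.infinitePi fun _ => (PMF.uniformOfFintype Bool).toMeasure

/-- The finite array `a` as memory content, padded with zeros. -/
def ofArray {m n : ℕ} (a : Fin m → Fin n → ℝ) (i j : ℕ) : ℝ :=
  if h : i < m ∧ j < n then a ⟨i, h.1⟩ ⟨j, h.2⟩ else 0

/-- Initial states: natural-number registers 0, 1, 2 hold `m`, `n` and the format flag, real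
registers 0, 1, 2 hold `γ`, `H`, `δ`, array 0 holds the data, and all else is zero. -/
def initial {m n : ℕ} (flag : ℕ) (a : Fin m → Fin n → ℝ) (γ H δ : ℝ) : State where
  nat := fun x => if x = 0 then m else if x = 1 then n else if x = 2 then flag else 0
  real := fun r => if r = 0 then γ else if r = 1 then H else if r = 2 then δ else 0
  mem := fun b => if b = 0 then ofArray a else fun _ _ => 0
  flips := 0

/-- The input that gives the pool as `m` vectors in `ℝ^d` (format flag 0). -/
def vectorInput {m d : ℕ} (x : Fin m → EuclideanSpace ℝ (Fin d)) (γ H δ : ℝ) : State :=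
  initial 0 (fun i j => x i j) γ H δ

/-- The input that gives the pool as an `m × m` kernel matrix (format flag 1). -/
def kernelInput {m : ℕ} (K : Matrix (Fin m) (Fin m) ℝ) (γ H δ : ℝ) : State :=
  initial 1 (fun i j => K i j) γ H δ

/-- The final state holds the output `y`: `k` is in natural-number register 3 and the points
`y 0, …, y (m - 1)` are the rows of array 1. -/
def State.Outputs (s : State) {m k : ℕ} (y : Fin m → EuclideanSpace ℝ (Fin k)) : Prop :=
  s.nat 3 = k ∧ ∀ (i : Fin m) (j : Fin k), s.mem 1 i j = y i j

end RealRAM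

/-- `∑ i, max(0, γ - L i * ⟨w, x i⟩)²`. -/
def squaredHingeLoss {E : Type*} [NormedAddCommGroup E] [InnerProductSpace ℝ E] {m : ℕ}
    (γ : ℝ) (x : Fin m → E) (L : Fin m → ℝ) (w : E) : ℝ :=
  ∑ i, (max 0 (γ - L i * inner ℝ w (x i))) ^ 2

/-- The labelled pool `(x, L)` is separable with margin `η` by a homogeneous halfspace. -/
def SeparableWithMargin {E : Type*} [NormedAddCommGroup E] [InnerProductSpace ℝ E] {m : ℕ}
    (x : Fin m → E) (L : Fin m → ℝ) (η : ℝ) : Prop :=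
  ∃ w : E, ‖w‖ ≤ 1 ∧ ∀ i, η ≤ L i * inner ℝ w (x i)

/-- Started on `input` (a representation of the pool `x` with the parameters `γ`, `H`, `δ`), the
program `P` always halts within `T` steps and outputs points in `ℝ^k`, where `k` satisfies the
dimension bound with constant `C`. For every labelling `L` of `x` for which some vector of the unit
ball has squared hinge loss at most `H`, with probability at least `1 - δ` over the coins the
output is contained in the unit ball and separable by `L` with margin `γ / (2 + 2 √H)`. -/
def Preprocesses (P : RealRAM.Program) (input : RealRAM.State) (T C : ℝ)
    {E : Type*} [NormedAddCommGroup E] [InnerProductSpace ℝ E] {m : ℕ}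
    (x : Fin m → E) (γ H δ : ℝ) : Prop :=
  ∃ (k : ℕ) (y : (ℕ → Bool) → Fin m → EuclideanSpace ℝ (Fin k)),
    k ≤ ⌈C * ((H + 1) * Real.log (m / δ) / γ ^ 2)⌉₊ ∧
    (∀ ω, ∃ (s : RealRAM.State) (t : ℕ),
      RealRAM.Exec ω P input s t ∧ (t : ℝ) ≤ T ∧ s.Outputs (y ω)) ∧
    ∀ L : Fin m → ℝ, (∀ i, L i = 1 ∨ L i = -1) →
      (∃ w : E, ‖w‖ ≤ 1 ∧ squaredHingeLoss γ x L w ≤ H) →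
      ENNReal.ofReal (1 - δ) ≤ RealRAM.coins
        {ω | (∀ i, ‖y ω i‖ ≤ 1) ∧ SeparableWithMargin (y ω) L (γ / (2 + 2 * Real.sqrt H))}

end

/-! Give every point a private coordinate: with θ = 1/(1+√H), replace x_i by (√θ x_i, √(1-θ) e_i).
If w has squared hinge loss at most H, with slacks ξ_i, then (w, (L_i ξ_i / H^(1/4))_i) / √(1+√H)
lies in the unit ball, and its extra coordinates pay for the slacks: the extended points are
separated with margin η = γ/(1+√H) at every point (`separable_extendedPoint`). Since η² ≥
γ²/(2(H+1)), a random projection to a multiple of log(m/δ)/η² dimensions, with suitable scaling,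
keeps all points in the unit ball and half of the margin with probability 1-δ
(`coins_projectedPoint`).

None of this uses the labelling, and the points enter only through the Gram matrix θK + (1-θ)I of
the extended points. Its Cholesky decomposition gives vectors in ℝ^m with the same inner products
(`sum_column_mul_column`), and a separating vector can be carried over to them
(`exists_inner_eq_of_gram_eq`). They are multiplied by a matrix of random signs. The tail bound
`card_deviation_le` is a Chernoff bound; it rests on E exp(S²/4) ≤ 2 for the randomly signed sum S
of the entries of a vector in the unit ball. A union bound over 2m+1 events finishes the argument.

The dimension, and with it the running time, is polynomial in the admitted parameters only if H is
not too large. For H ≥ mγ² the standard basis of ℝ^m is a valid output: every labelling separates it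
with margin 1/√m, and m ≤ H/γ². The case m = 1 is answered in the same way.

On the side of the machine, `Reaches` is a Hoare logic for total correctness that counts steps. Its
frame rule `Exec.agree` reduces the preservation of registers and arrays to a decidable check on the
program text. -/

namespace RealRAM

variable {ω : ℕ → Bool}

/-! ### Registers and arrays written by a program -/

def Instr.natTargets : Instr → List ℕ
  | .natConst x _ | .natAdd x _ _ | .natSub x _ _ => [x]
  | _ => []

def Instr.realTargets : Instr → List ℕ
  | .realConst r _ | .realOfNat r _ | .realAdd r _ _ | .realSub r _ _ | .realMul r _ _
  | .realDiv r _ _ | .realSqrt r _ | .load r _ _ _ | .flip r => [r]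
  | _ => []

def Instr.memTargets : Instr → List ℕ
  | .store a _ _ _ => [a]
  | _ => []

def Instr.coinFree : Instr → Bool
  | .flip _ => false
  | _ => true

/-- The list of targets of a program, given those of the instructions. -/
def Program.targets (f : Instr → List ℕ) : Program → List ℕ
  | .skip => []
  | .instr i => f i
  | .seq p q => p.targets f ++ q.targets f
  | .ite _ p q => p.targets f ++ q.targets f
  | .while _ p => p.targets f

def Program.coinFree : Program → Bool
  | .skip => true
  | .instr i => i.coinFree
  | .seq p q => p.coinFree && q.coinFree
  | .ite _ p q => p.coinFree && q.coinFree
  | .while _ p => p.coinFree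

/-- `s'` agrees with `s` on everything that `p` has no instruction to modify. -/
structure Agree (p : Program) (s s' : State) : Prop where
  nat : ∀ x, x ∉ p.targets Instr.natTargets → s'.nat x = s.nat x
  real : ∀ r, r ∉ p.targets Instr.realTargets → s'.real r = s.real r
  mem : ∀ a, a ∉ p.targets Instr.memTargets → s'.mem a = s.mem a
  flips : p.coinFree = true → s'.flips = s.flips

theorem Agree.refl (p : Program) (s : State) : Agree p s s :=
  ⟨fun _ _ => rfl, fun _ _ => rfl, fun _ _ => rfl, fun _ => rfl⟩

theorem Agree.trans {p : Program} {s s' s'' : State} (h : Agree p s s') (h' : Agree p s' s'') :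
    Agree p s s'' :=
  ⟨fun x hx => (h'.nat x hx).trans (h.nat x hx), fun x hx => (h'.real x hx).trans (h.real x hx),
    fun x hx => (h'.mem x hx).trans (h.mem x hx), fun hp => (h'.flips hp).trans (h.flips hp)⟩

theorem Agree.mono {p q : Program} {s s' : State} (h : Agree p s s')
    (hn : ∀ x ∈ p.targets Instr.natTargets, x ∈ q.targets Instr.natTargets)
    (hr : ∀ x ∈ p.targets Instr.realTargets, x ∈ q.targets Instr.realTargets)
    (hm : ∀ x ∈ p.targets Instr.memTargets, x ∈ q.targets Instr.memTargets)
    (hf : q.coinFree = true → p.coinFree = true) : Agree q s s' :=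
  ⟨fun x hx => h.nat x fun h' => hx (hn x h'), fun x hx => h.real x fun h' => hx (hr x h'),
    fun x hx => h.mem x fun h' => hx (hm x h'), fun hq => h.flips (hf hq)⟩

theorem agree_run (ω : ℕ → Bool) (i : Instr) (s : State) : Agree (.instr i) s (i.run ω s) := by
  constructor
  · intro x hx
    cases i <;> simp_all [Program.targets, Instr.natTargets, Instr.run, State.setNat,
      State.setReal, State.setMem]
  · intro x hx
    cases i <;> simp_all [Program.targets, Instr.realTargets, Instr.run, State.setNat,
      State.setReal, State.setMem]
  · intro x hx
    cases i <;> simp_all [Program.targets, Instr.memTargets, Instr.run, State.setNat,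
      State.setReal, State.setMem]
  · intro hx
    cases i <;> simp_all [Program.coinFree, Instr.coinFree, Instr.run, State.setNat,
      State.setReal, State.setMem]

/-- The frame rule. Non-membership in a target list is decidable for a concrete program, so every
later claim that a register or an array survives is settled by `decide`. -/
theorem Exec.agree {ω : ℕ → Bool} {p : Program} {s s' : State} {t : ℕ} (h : Exec ω p s s' t) :
    Agree p s s' := by
  induction h with
  | skip s => exact Agree.refl _ _
  | instr i s => exact agree_run ω i s
  | seq _ _ h h' =>
    exact (h.mono (by simp +contextual [Program.targets]) (by simp +contextual [Program.targets])
      (by simp +contextual [Program.targets]) (by simp +contextual [Program.coinFree])).trans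
      (h'.mono (by simp +contextual [Program.targets]) (by simp +contextual [Program.targets])
      (by simp +contextual [Program.targets]) (by simp +contextual [Program.coinFree]))
  | ite_true _ _ h =>
    exact h.mono (by simp +contextual [Program.targets]) (by simp +contextual [Program.targets])
      (by simp +contextual [Program.targets]) (by simp +contextual [Program.coinFree])
  | ite_false _ _ h =>
    exact h.mono (by simp +contextual [Program.targets]) (by simp +contextual [Program.targets])
      (by simp +contextual [Program.targets]) (by simp +contextual [Program.coinFree])
  | while_true _ _ _ h h' =>
    exact (h.mono (by simp +contextual [Program.targets]) (by simp +contextual [Program.targets])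
      (by simp +contextual [Program.targets]) (by simp +contextual [Program.coinFree])).trans h'
  | while_false _ => exact Agree.refl _ _

/-! ### Total correctness with a time bound -/

/-- Started in `s`, the program `p` halts within `T` steps in a state that satisfies `Q`. -/
def Reaches (ω : ℕ → Bool) (p : Program) (s : State) (T : ℕ) (Q : State → Prop) : Prop :=
  ∃ s' t, Exec ω p s s' t ∧ t ≤ T ∧ Q s'

/-- The implication between postconditions may use the frame information `Agree p s s'`, so a
specification has to mention only what the program changes. The same holds for the intermediate
assertion in `Reaches.seq`. -/
theorem Reaches.mono {p : Program} {s : State} {T T' : ℕ} {Q Q' : State → Prop}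
    (h : Reaches ω p s T Q) (hT : T ≤ T') (hQ : ∀ s', Agree p s s' → Q s' → Q' s') :
    Reaches ω p s T' Q' := by
  obtain ⟨s', t, h1, h2, h3⟩ := h
  exact ⟨s', t, h1, h2.trans hT, hQ s' h1.agree h3⟩

theorem Reaches.skip {s : State} {Q : State → Prop} (h : Q s) : Reaches ω .skip s 0 Q :=
  ⟨s, 0, .skip s, le_rfl, h⟩

theorem Reaches.instr {i : Instr} {s : State} {Q : State → Prop} (h : Q (i.run ω s)) :
    Reaches ω (.instr i) s 1 Q :=
  ⟨_, 1, .instr i s, le_rfl, h⟩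

theorem Reaches.seq {p q : Program} {s : State} {T U : ℕ} {R Q : State → Prop}
    (h : Reaches ω p s T R) (h' : ∀ s', Agree p s s' → R s' → Reaches ω q s' U Q) :
    Reaches ω (.seq p q) s (T + U) Q := by
  obtain ⟨s', t, h1, h2, h3⟩ := h
  obtain ⟨s'', u, h4, h5, h6⟩ := h' s' h1.agree h3
  exact ⟨s'', t + u, .seq h1 h4, add_le_add h2 h5, h6⟩

theorem Reaches.ite {c : Test} {p q : Program} {s : State} {T : ℕ} {Q : State → Prop}
    (h : c.Holds s → Reaches ω p s T Q) (h' : ¬ c.Holds s → Reaches ω q s T Q) :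
    Reaches ω (.ite c p q) s (T + 1) Q := by
  by_cases hc : c.Holds s
  · obtain ⟨s', t, h1, h2, h3⟩ := h hc
    exact ⟨s', t + 1, .ite_true hc h1, by omega, h3⟩
  · obtain ⟨s', t, h1, h2, h3⟩ := h' hc
    exact ⟨s', t + 1, .ite_false hc h1, by omega, h3⟩

/-- The invariant is indexed by the number of completed rounds, and the number `N` of rounds is
fixed beforehand. Each round pays one extra step for its test, and the final failing test pays one
more. -/
theorem Reaches.while {c : Test} {p : Program} {s : State} {T N : ℕ} (I : ℕ → State → Prop)
    (h0 : I 0 s)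
    (hstep : ∀ n s', n < N → I n s' → c.Holds s' ∧ Reaches ω p s' T (I (n + 1)))
    (hend : ∀ s', I N s' → ¬ c.Holds s') :
    Reaches ω (.while c p) s (N * (T + 1) + 1) (I N) := by
  have key : ∀ r n s', n + r = N → I n s' →
      Reaches ω (.while c p) s' (r * (T + 1) + 1) (I N) := by
    intro r
    induction r with
    | zero =>
      intro n s' hn hI
      obtain rfl : n = N := by omega
      exact ⟨s', 1, .while_false (hend _ hI), by omega, hI⟩
    | succ r ih =>
      intro n s' hn hI
      obtain ⟨hc, s₁, t, h1, h2, h3⟩ := hstep n s' (by omega) hI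
      obtain ⟨s₂, u, h4, h5, h6⟩ := ih (n + 1) s₁ (by omega) h3
      exact ⟨s₂, t + u + 1, .while_true hc h1 h4, by rw [add_mul]; omega, h6⟩
  exact key N 0 s (by omega) h0

/-- A list of instructions as a program. -/
def block : List Instr → Program
  | [] => .skip
  | i :: l => .seq (.instr i) (block l)

theorem Reaches.block {l : List Instr} {s : State} {Q : State → Prop}
    (h : Q (l.foldl (Instr.run ω) s)) : Reaches ω (block l) s l.length Q := by
  induction l generalizing s with
  | nil => exact Reaches.skip h
  | cons i l ih =>
    have := Reaches.seq (p := .instr i) (R := fun s' => s' = i.run ω s) (Reaches.instr rfl)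
      (q := RealRAM.block l) (U := l.length) (Q := Q) (fun s' _ hs => by subst hs; exact ih h)
    rw [List.length_cons, add_comm]
    exact this

/-! ### Bounded loops -/

/-- The loop in which the natural-number register `i` runs from `0` to the content of register
`b`, exclusively. Register `4` has to hold `1`. -/
def forLoop (i b : ℕ) (p : Program) : Program :=
  .seq (.instr (.natConst i 0))
    (.while (.natLt i b) (.seq p (.instr (.natAdd i i 4))))

/-- The program `p` can be the body of a loop with counter `i` and bound `b`. -/
def LoopBody (i b : ℕ) (p : Program) : Prop :=
  i ≠ b ∧ i ≠ 4 ∧ i ∉ p.targets Instr.natTargets ∧ b ∉ p.targets Instr.natTargets ∧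
    4 ∉ p.targets Instr.natTargets

instance (i b : ℕ) (p : Program) : Decidable (LoopBody i b p) :=
  inferInstanceAs (Decidable (_ ∧ _))

/-- The invariant is stated for the state after the increment of the counter, hence the `setNat` in
the conclusion on the body. Test and increment cost two steps per round; the initialization and the
last test cost two more. -/
theorem Reaches.forLoop {i b : ℕ} {p : Program} (hp : LoopBody i b p) {s : State}
    (h1 : s.nat 4 = 1) {T : ℕ} (I : ℕ → State → Prop) (h0 : I 0 (s.setNat i 0))
    (hstep : ∀ n s', n < s.nat b → Agree (forLoop i b p) s s' → s'.nat i = n → I n s' →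
      Reaches ω p s' T (fun s'' => I (n + 1) (s''.setNat i (n + 1)))) :
    Reaches ω (forLoop i b p) s (s.nat b * (T + 2) + 2) (I (s.nat b)) := by
  obtain ⟨hib, hi4, hi, hb, h4⟩ := hp
  have hib' : b ≠ i := fun h => hib h.symm
  have hi4' : 4 ≠ i := fun h => hi4 h.symm
  have hb' : b ∉ (RealRAM.forLoop i b p).targets Instr.natTargets := by
    simp [RealRAM.forLoop, Program.targets, Instr.natTargets, hib', hb]
  have h4' : 4 ∉ (RealRAM.forLoop i b p).targets Instr.natTargets := by
    simp [RealRAM.forLoop, Program.targets, Instr.natTargets, hi4', h4]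
  have hw := Reaches.while (ω := ω) (c := .natLt i b) (p := .seq p (.instr (.natAdd i i 4)))
    (s := s.setNat i 0) (T := T + 1) (N := s.nat b)
    (fun n s' => Agree (RealRAM.forLoop i b p) s s' ∧ s'.nat i = n ∧ I n s')
    ⟨(agree_run ω (.natConst i 0) s).mono
      (by simp +contextual [RealRAM.forLoop, Program.targets])
      (by simp +contextual [RealRAM.forLoop, Program.targets])
      (by simp +contextual [RealRAM.forLoop, Program.targets])
      (by simp [Program.coinFree, Instr.coinFree]), by simp [State.setNat], h0⟩
    (by
      rintro n s' hn ⟨hA, hin, hI⟩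
      refine ⟨?_, ?_⟩
      · change s'.nat i < s'.nat b
        rw [hin, hA.nat b hb']
        exact hn
      refine Reaches.seq (hstep n s' hn hA hin hI) fun s'' hA' hQ => Reaches.instr ?_
      have e : Instr.run ω s'' (.natAdd i i 4) = s''.setNat i (n + 1) := by
        simp only [Instr.run]
        rw [hA'.nat i hi, hA'.nat 4 h4, hin, hA.nat 4 h4', h1]
      refine ⟨(hA.trans (hA'.mono ?_ ?_ ?_ ?_)).trans
        ((agree_run ω (.natAdd i i 4) s'').mono ?_ ?_ ?_ ?_), ?_, ?_⟩
      any_goals simp +contextual [RealRAM.forLoop, Program.targets, Program.coinFree,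
        Instr.coinFree]
      · rw [e]; simp [State.setNat]
      · rw [e]; exact hQ)
    (by
      rintro s' ⟨hA, hin, -⟩
      change ¬ s'.nat i < s'.nat b
      rw [hin, hA.nat b hb']
      exact lt_irrefl _)
  refine (Reaches.seq (p := .instr (.natConst i 0)) (R := fun s' => s' = s.setNat i 0)
    (Reaches.instr rfl) (fun s' _ hs => by subst hs; exact hw)).mono (by
      have : s.nat b * (T + 1 + 1) = s.nat b * (T + 2) := rfl
      omega) ?_
  exact fun s' _ h => h.2.2

/-- The nested loops that store at each position `(i, j)` of array `a` below the bounds `b` and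
`b'` the content of the real register `r` after running `p`. -/
def fill (a i j b b' r : ℕ) (p : Program) : Program :=
  forLoop i b (forLoop j b' (.seq p (.instr (.store a i j r))))

/-- The program `p` can be used in `fill`. -/
def FillBody (a i j b b' : ℕ) (p : Program) : Prop :=
  LoopBody i b p ∧ LoopBody j b' p ∧ i ≠ j ∧ j ≠ b ∧ i ≠ b' ∧ a ∉ p.targets Instr.memTargets

instance (a i j b b' : ℕ) (p : Program) : Decidable (FillBody a i j b b' p) :=
  inferInstanceAs (Decidable (_ ∧ _))

/-- Each entry is written only once, so the body still finds the original value at the position that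
it is about to overwrite. This permits updates of an array in place. -/
theorem Reaches.fill {a i j b b' r : ℕ} {p : Program} (hp : FillBody a i j b b' p) {s : State}
    (h1 : s.nat 4 = 1) {T : ℕ} (f : ℕ → ℕ → ℝ)
    (hstep : ∀ u v s', u < s.nat b → v < s.nat b' → Agree (fill a i j b b' r p) s s' →
      s'.nat i = u → s'.nat j = v → s'.mem a u v = s.mem a u v →
      Reaches ω p s' T (fun s'' => s''.real r = f u v)) :
    Reaches ω (fill a i j b b' r p) s (s.nat b * (s.nat b' * (T + 3) + 4) + 2)
      (fun s' => ∀ u v, s'.mem a u v = if u < s.nat b ∧ v < s.nat b' then f u v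
        else s.mem a u v) := by
  obtain ⟨⟨hib, hi4, hi, hb, h4⟩, ⟨hjb, hj4, hj, hb', -⟩, hij, hjb2, hib2, ha⟩ := hp
  have t1 : ∀ x, x ∉ p.targets Instr.natTargets → x ≠ i → x ≠ j →
      x ∉ (RealRAM.fill a i j b b' r p).targets Instr.natTargets := by
    intro x hx hxi hxj
    simp [RealRAM.fill, RealRAM.forLoop, Program.targets, Instr.natTargets, hx, hxi, hxj]
  have t2 : ∀ x, x ∉ p.targets Instr.natTargets → x ≠ j →
      x ∉ (RealRAM.forLoop j b' (.seq p (.instr (.store a i j r)))).targets Instr.natTargets := by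
    intro x hx hxj
    simp [RealRAM.forLoop, Program.targets, Instr.natTargets, hx, hxj]
  refine (Reaches.forLoop (i := i) (b := b) ⟨hib, hi4, t2 i hi hij, t2 b hb hjb2.symm,
    t2 4 h4 hj4.symm⟩ h1 (T := s.nat b' * (T + 3) + 2)
    (fun n s' => ∀ u v, s'.mem a u v = if u < n ∧ v < s.nat b' then f u v else s.mem a u v)
    (by intro u v; simp [State.setNat]) ?_).mono (by simp [add_assoc]) (fun s' _ h => h)
  intro n s' hn hA hin hI
  have eb : s'.nat b' = s.nat b' := hA.nat b' (t1 b' hb' hib2.symm hjb.symm)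
  have e4 : s'.nat 4 = 1 := (hA.nat 4 (t1 4 h4 hi4.symm hj4.symm)).trans h1
  refine (Reaches.forLoop (i := j) (b := b') (s := s') (ω := ω)
    (p := .seq p (.instr (.store a i j r)))
    ⟨hjb, hj4, by simp [Program.targets, Instr.natTargets, hj],
      by simp [Program.targets, Instr.natTargets, hb'],
      by simp [Program.targets, Instr.natTargets, h4]⟩ e4 (T := T + 1)
    (fun l s'' => ∀ u v, s''.mem a u v =
      if (u < n ∧ v < s.nat b') ∨ (u = n ∧ v < l) then f u v else s.mem a u v)
    (by intro u v; simpa [State.setNat] using hI u v) ?_).mono (by rw [eb]) ?_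
  · intro l s'' hl hA' hjl hI'
    rw [eb] at hl
    have hA'' : Agree (RealRAM.fill a i j b b' r p) s s'' := by
      refine hA.trans (hA'.mono ?_ ?_ ?_ ?_) <;>
        simp [RealRAM.forLoop, Program.targets, Program.coinFree] <;> tauto
    have ein : s''.nat i = n := (hA'.nat i (t2 i hi hij)).trans hin
    refine Reaches.seq (hstep n l s'' hn hl hA'' ein hjl (by simp [hI' n l]))
      fun s₁ hA₁ h₁ => Reaches.instr ?_
    intro u v
    have e1 : s₁.nat i = n := (hA₁.nat i hi).trans ein
    have e2 : s₁.nat j = l := (hA₁.nat j hj).trans hjl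
    simp only [Instr.run, State.setNat, State.setMem, e1, e2, h₁, true_and]
    by_cases huv : u = n ∧ v = l
    · obtain ⟨rfl, rfl⟩ := huv
      simp
    · rw [if_neg huv, hA₁.mem a ha, hI' u v]
      congr 1
      apply propext
      constructor
      · rintro (h | h)
        · exact Or.inl h
        · exact Or.inr ⟨h.1, by omega⟩
      · rintro (h | h)
        · exact Or.inl h
        · exact Or.inr ⟨h.1, by omega⟩
  · intro s'' _ h u v
    simp only [State.setNat, h, eb]
    congr 1
    apply propext
    constructor
    · rintro (h | h) <;> exact ⟨by omega, h.2⟩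
    · rintro ⟨h, h'⟩
      rcases Nat.lt_succ_iff_lt_or_eq.mp h with h | h
      · exact Or.inl ⟨h, h'⟩
      · exact Or.inr ⟨h, h'⟩

/-! ### The preprocessing program -/

/-- Writes the identity matrix to array 1 and sets the output dimension to the pool size. -/
def identityProgram : Program :=
  .seq (block [.natConst 4 1, .realConst 3 1, .natAdd 3 0 5])
    (forLoop 6 0 (.instr (.store 1 6 6 3)))

/-- Computes the binary logarithm of `m / δ`, rounded up, in real register 5. -/
def logProgram : Program :=
  .seq (block [.realOfNat 4 0, .realConst 5 0])
    (.while (.realLt 2 4) (block [.realAdd 2 2 2, .realAdd 5 5 3]))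

/-- Computes the output dimension in natural-number register 3. -/
def dimProgram : Program :=
  .seq (block [.realMul 7 0 0, .realConst 6 200000, .realAdd 8 1 3, .realMul 6 6 8, .realMul 6 6 5,
      .realConst 8 0, .natConst 3 0])
    (.while (.realLt 8 6) (block [.natAdd 3 3 4, .realAdd 8 8 7]))

/-- Computes in real register 11 the inner product of the points numbered by the registers 6, 7. -/
def innerProgram : Program :=
  .ite (.natLt 2 4)
    (.seq (.instr (.realConst 11 0))
      (forLoop 8 1 (block [.load 12 0 6 8, .load 13 0 7 8, .realMul 12 12 13, .realAdd 11 11 12])))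
    (.instr (.load 11 0 6 7))

/-- Computes the kernel matrix of the extended points in array 2. -/
def kernelProgram : Program :=
  .seq (block [.realSqrt 9 1, .realAdd 9 3 9, .realDiv 9 3 9, .realSub 10 3 9])
    (fill 2 6 7 0 0 11 (.seq innerProgram
      (block [.realMul 11 11 9, .load 12 1 6 7, .realMul 12 12 10, .realAdd 11 11 12])))

/-- Fills array 6 with random signs. -/
def signProgram : Program :=
  forLoop 9 0 (forLoop 7 3 (block [.flip 11, .store 6 9 7 11]))

/-- One round of the Cholesky decomposition of array 2. The new column is projected with the signs
in array 6 and added to array 5. -/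
def roundProgram : Program :=
  .seq (block [.load 14 2 9 9, .realSqrt 14 14])
    (.seq (fill 3 6 7 0 4 11 (block [.load 11 2 6 9, .realDiv 11 11 14]))
      (.seq (fill 2 6 7 0 0 11 (block [.load 11 2 6 7, .load 12 3 6 5, .load 13 3 7 5,
          .realMul 12 12 13, .realSub 11 11 12]))
        (fill 5 6 7 0 3 11 (block [.load 11 5 6 7, .load 12 3 6 5, .load 13 6 9 7,
          .realMul 12 12 13, .realAdd 11 11 12]))))

/-- Scales array 5 and writes the result to array 1. -/
def scaleProgram : Program :=
  .seq (block [.realOfNat 11 3, .realConst 12 (5 / 4), .realMul 11 11 12, .realDiv 11 3 11,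
      .realSqrt 14 11])
    (fill 1 6 7 0 3 11 (block [.load 11 5 6 7, .realMul 11 11 14]))

def projectionProgram : Program :=
  .seq logProgram (.seq dimProgram (.seq kernelProgram (.seq signProgram
    (.seq (forLoop 9 0 roundProgram) scaleProgram))))

/-- The projection runs only for m > 1 and H < mγ². The second condition bounds (H+1)/γ² by m + 1/γ²
and so keeps the running time polynomial; the first one makes the rounded logarithm comparable with
log(m/δ). Otherwise the standard basis, already in array 1, is the output. -/
def preprocessing : Program :=
  .seq identityProgram
    (.ite (.natLt 4 0)
      (.seq (block [.realOfNat 4 0, .realMul 7 0 0, .realMul 5 4 7])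
        (.ite (.realLe 5 1) .skip projectionProgram))
      .skip)

/-! ### Correctness of the parts -/

/-- From here on the natural-number registers 4 and 5 serve as the constants 1 and 0, and the real
register 3 as the constant 1. Adding register 5 amounts to copying. -/
theorem reaches_identityProgram {s : State} (h5 : s.nat 5 = 0) (h1 : s.mem 1 = fun _ _ => 0) :
    Reaches ω identityProgram s (3 * s.nat 0 + 5) (fun s' => s'.nat 4 = 1 ∧ s'.real 3 = 1 ∧
      s'.nat 3 = s.nat 0 ∧
      ∀ u v, s'.mem 1 u v = if u = v ∧ u < s.nat 0 then 1 else 0) := by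
  refine (Reaches.seq (U := 3 * s.nat 0 + 2) (Reaches.block (Q := fun s' => s'.nat 4 = 1 ∧
    s'.real 3 = 1 ∧ s'.nat 3 = s.nat 0)
    (by simp [Instr.run, State.setNat, State.setReal, h5])) ?_).mono
    (by simp only [List.length_cons, List.length_nil]; omega) (fun s' _ h => h)
  rintro s₁ hA ⟨h4, h3, hk⟩
  have e0 : s₁.nat 0 = s.nat 0 := hA.nat 0 (by decide)
  have e1 : s₁.mem 1 = s.mem 1 := hA.mem 1 (by decide)
  refine (Reaches.forLoop (by decide) h4 (T := 1)
    (fun c s' => ∀ u v, s'.mem 1 u v = if u = v ∧ u < c then 1 else 0)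
    (by intro u v; simp [State.setNat, e1, h1]) ?_).mono (by rw [e0]; omega) ?_
  · intro n s' _ hA' hn hI
    refine Reaches.instr fun u v => ?_
    have e3 : s'.real 3 = 1 := (hA'.real 3 (by decide)).trans h3
    simp only [Instr.run, State.setNat, State.setMem, hn, hI u v, e3]
    grind
  · intro s' hA' hI
    refine ⟨(hA'.nat 4 (by decide)).trans h4, (hA'.real 3 (by decide)).trans h3,
      (hA'.nat 3 (by decide)).trans hk, ?_⟩
    rw [← e0]
    exact hI

theorem reaches_logProgram {s : State} (h3 : s.real 3 = 1) (hδ : 0 < s.real 2)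
    (hm : 0 < s.nat 0) :
    Reaches ω logProgram s (3 * ⌈Real.logb 2 (s.nat 0 / s.real 2)⌉₊ + 3)
      (fun s' => s'.real 5 = ⌈Real.logb 2 (s.nat 0 / s.real 2)⌉₊) := by
  set N := ⌈Real.logb 2 (s.nat 0 / s.real 2)⌉₊ with hN
  -- The logarithm is found by doubling δ until it reaches m; this equivalence says that the loop
  -- makes exactly `N` rounds.
  have hlt : ∀ c : ℕ, s.real 2 * 2 ^ c < s.nat 0 ↔ c < N := by
    intro c
    rw [hN, Nat.lt_ceil, Real.lt_logb_iff_rpow_lt one_lt_two (by positivity), Real.rpow_natCast,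
      lt_div_iff₀ hδ, mul_comm]
  refine (Reaches.seq (U := N * 3 + 1) (Reaches.block (Q := fun s' => s'.real 4 = s.nat 0 ∧
    s'.real 5 = 0) (by simp [Instr.run, State.setReal])) ?_).mono
    (by simp only [List.length_cons, List.length_nil]; omega) (fun s' _ h => h)
  rintro s₁ hA ⟨h4, h5⟩
  refine (Reaches.while (T := 2) (N := N) (fun c s' => s'.real 2 = s.real 2 * 2 ^ c ∧
    s'.real 5 = c ∧ s'.real 4 = s.nat 0 ∧ s'.real 3 = 1)
    ⟨by simpa using hA.real 2 (by decide), by simpa using h5, h4,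
      (hA.real 3 (by decide)).trans h3⟩ ?_ ?_).mono (by omega) (fun s' _ h => h.2.1)
  · rintro n s' hn ⟨i1, i2, i3, i4⟩
    refine ⟨?_, Reaches.block ?_⟩
    · change s'.real 2 < s'.real 4
      rw [i1, i3]
      exact (hlt n).2 hn
    · simp [Instr.run, State.setReal, i1, i2, i3, i4]
      ring
  · rintro s' ⟨i1, i2, i3, i4⟩
    change ¬ s'.real 2 < s'.real 4
    rw [i1, i3, hlt]
    exact lt_irrefl _

theorem reaches_dimProgram {s : State} (h3 : s.real 3 = 1) (h4 : s.nat 4 = 1)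
    (hγ : 0 < s.real 0) :
    Reaches ω dimProgram s
      (3 * ⌈200000 * (s.real 1 + 1) * s.real 5 / s.real 0 ^ 2⌉₊ + 8)
      (fun s' => s'.nat 3 = ⌈200000 * (s.real 1 + 1) * s.real 5 / s.real 0 ^ 2⌉₊) := by
  set N := ⌈200000 * (s.real 1 + 1) * s.real 5 / s.real 0 ^ 2⌉₊ with hN
  -- Rounding up without a floor operation: multiples of γ² are counted until they reach the
  -- numerator.
  have hlt : ∀ c : ℕ, c * s.real 0 ^ 2 < 200000 * (s.real 1 + 1) * s.real 5 ↔ c < N := by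
    intro c
    rw [hN, Nat.lt_ceil, lt_div_iff₀ (by positivity)]
  refine (Reaches.seq (U := N * 3 + 1) (Reaches.block (Q := fun s' => s'.real 7 = s.real 0 ^ 2 ∧
    s'.real 6 = 200000 * (s.real 1 + 1) * s.real 5 ∧ s'.real 8 = 0 ∧ s'.nat 3 = 0)
    (by simp [Instr.run, State.setReal, State.setNat, h3, sq])) ?_).mono
    (by simp only [List.length_cons, List.length_nil]; omega) (fun s' _ h => h)
  rintro s₁ hA ⟨h7, h6, h8, hk⟩
  refine (Reaches.while (T := 2) (N := N) (fun c s' => s'.real 8 = c * s.real 0 ^ 2 ∧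
    s'.nat 3 = c ∧ s'.real 6 = 200000 * (s.real 1 + 1) * s.real 5 ∧ s'.real 7 = s.real 0 ^ 2 ∧
    s'.nat 4 = 1)
    ⟨by simpa using h8, hk, h6, h7, (hA.nat 4 (by decide)).trans h4⟩ ?_ ?_).mono
    (by omega) (fun s' _ h => h.2.1)
  · rintro n s' hn ⟨i1, i2, i3, i4, i5⟩
    refine ⟨?_, Reaches.block ?_⟩
    · change s'.real 8 < s'.real 6
      rw [i1, i3]
      exact (hlt n).2 hn
    · simp [Instr.run, State.setReal, State.setNat, i1, i2, i3, i4, i5]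
      ring
  · rintro s' ⟨i1, i2, i3, i4, i5⟩
    change ¬ s'.real 8 < s'.real 6
    rw [i1, i3, hlt]
    exact lt_irrefl _

/-- The kernel matrix of the pool that is given by array 0 in either format. -/
def inputKernel (s : State) (u v : ℕ) : ℝ :=
  if s.nat 2 = 0 then ∑ t ∈ Finset.range (s.nat 1), s.mem 0 u t * s.mem 0 v t else s.mem 0 u v

theorem reaches_innerProgram {s : State} (h4 : s.nat 4 = 1) :
    Reaches ω innerProgram s (6 * s.nat 1 + 4)
      (fun s' => s'.real 11 = inputKernel s (s.nat 6) (s.nat 7)) := by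
  refine (Reaches.ite (T := 6 * s.nat 1 + 3) (fun hc => ?_) (fun hc => ?_)).mono
    le_rfl (fun s' _ h => h)
  · change s.nat 2 < s.nat 4 at hc
    have h2 : s.nat 2 = 0 := by omega
    refine (Reaches.seq (U := 6 * s.nat 1 + 2) (Reaches.instr (Q := fun s' => s'.real 11 = 0)
      (by simp [Instr.run, State.setReal])) ?_).mono (by omega) (fun s' _ h => h)
    intro s₁ hA h11
    have e1 : s₁.nat 1 = s.nat 1 := hA.nat 1 (by decide)
    refine (Reaches.forLoop (T := 4) (by decide) ((hA.nat 4 (by decide)).trans h4)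
      (fun c s' => s'.real 11 = ∑ t ∈ Finset.range c, s.mem 0 (s.nat 6) t * s.mem 0 (s.nat 7) t)
      (by simpa [State.setNat] using h11) ?_).mono (by rw [e1]; omega) ?_
    · intro n s' _ hA' hn hI
      have e6 : s'.nat 6 = s.nat 6 := (hA'.nat 6 (by decide)).trans (hA.nat 6 (by decide))
      have e7 : s'.nat 7 = s.nat 7 := (hA'.nat 7 (by decide)).trans (hA.nat 7 (by decide))
      have e0 : s'.mem 0 = s.mem 0 := (hA'.mem 0 (by decide)).trans (hA.mem 0 (by decide))
      refine Reaches.block ?_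
      simp [Instr.run, State.setReal, State.setNat, e6, e7, e0, hn, hI, Finset.sum_range_succ]
    · intro s' _ h
      rw [h, inputKernel, if_pos h2, e1]
  · change ¬ s.nat 2 < s.nat 4 at hc
    have h2 : s.nat 2 ≠ 0 := by omega
    refine (Reaches.instr (Q := fun s' => s'.real 11 = inputKernel s (s.nat 6) (s.nat 7)) ?_).mono
      (by omega) (fun s' _ h => h)
    simp [Instr.run, State.setReal, inputKernel, h2]

/-- The kernel matrix of the extended points. -/
noncomputable def extendedKernel (K : ℕ → ℕ → ℝ) (H : ℝ) (u v : ℕ) : ℝ :=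
  K u v * (1 / (1 + √H)) + (if u = v then 1 else 0) * (1 - 1 / (1 + √H))

theorem reaches_kernelProgram {s : State} (h4 : s.nat 4 = 1) (h3 : s.real 3 = 1)
    (h1 : ∀ u v, s.mem 1 u v = if u = v ∧ u < s.nat 0 then 1 else 0) :
    Reaches ω kernelProgram s (s.nat 0 * (s.nat 0 * (6 * s.nat 1 + 11) + 4) + 6)
      (fun s' => ∀ u v, u < s.nat 0 → v < s.nat 0 →
        s'.mem 2 u v = extendedKernel (inputKernel s) (s.real 1) u v) := by
  refine (Reaches.seq (U := s.nat 0 * (s.nat 0 * (6 * s.nat 1 + 11) + 4) + 2)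
    (Reaches.block (Q := fun s' => s'.real 9 = 1 / (1 + √(s.real 1)) ∧
      s'.real 10 = 1 - 1 / (1 + √(s.real 1)))
    (by simp [Instr.run, State.setReal, h3])) ?_).mono
    (by simp only [List.length_cons, List.length_nil]; omega) (fun s' _ h => h)
  rintro s₁ hA ⟨h9, h10⟩
  have e0 : s₁.nat 0 = s.nat 0 := hA.nat 0 (by decide)
  refine (Reaches.fill (T := 6 * s.nat 1 + 8) (by decide) ((hA.nat 4 (by decide)).trans h4)
    (extendedKernel (inputKernel s) (s.real 1)) ?_).mono (by rw [e0]) ?_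
  · intro u v s' hu _ hA' h6 h7 _
    have e4 : s'.nat 4 = 1 := ((hA'.nat 4 (by decide)).trans (hA.nat 4 (by decide))).trans h4
    have e1 : s'.nat 1 = s.nat 1 := (hA'.nat 1 (by decide)).trans (hA.nat 1 (by decide))
    have e2 : s'.nat 2 = s.nat 2 := (hA'.nat 2 (by decide)).trans (hA.nat 2 (by decide))
    have m0 : s'.mem 0 = s.mem 0 := (hA'.mem 0 (by decide)).trans (hA.mem 0 (by decide))
    refine (Reaches.seq (U := 4) (reaches_innerProgram e4) ?_).mono (by rw [e1])
      (fun s' _ h => h)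
    intro s'' hA'' h11
    refine Reaches.block ?_
    -- Array 1 still contains the identity matrix, which supplies the Kronecker delta of the
    -- extended kernel.
    have m1 : s''.mem 1 = s.mem 1 := ((hA''.mem 1 (by decide)).trans (hA'.mem 1 (by decide))).trans
      (hA.mem 1 (by decide))
    have r9 : s''.real 9 = 1 / (1 + √(s.real 1)) := ((hA''.real 9 (by decide)).trans
      (hA'.real 9 (by decide))).trans h9
    have r10 : s''.real 10 = 1 - 1 / (1 + √(s.real 1)) := ((hA''.real 10 (by decide)).trans
      (hA'.real 10 (by decide))).trans h10
    have e6 : s''.nat 6 = u := (hA''.nat 6 (by decide)).trans h6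
    have e7 : s''.nat 7 = v := (hA''.nat 7 (by decide)).trans h7
    have eK : inputKernel s' = inputKernel s := by
      funext u v
      simp only [inputKernel, e1, e2, m0]
    rw [e0] at hu
    simp [Instr.run, State.setReal, e6, e7, m1, r9, r10, h11, eK, h1, hu, h6, h7, extendedKernel]
  · intro s' _ h u v hu hv
    rw [h u v, if_pos (by rw [e0]; exact ⟨hu, hv⟩)]

theorem reaches_signProgram {s : State} (h4 : s.nat 4 = 1) (hf : s.flips = 0) :
    Reaches ω signProgram s (s.nat 0 * (s.nat 3 * 4 + 4) + 2)
      (fun s' => ∀ u v, u < s.nat 0 → v < s.nat 3 →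
        s'.mem 6 u v = if ω (u * s.nat 3 + v) then 1 else -1) := by
  refine (Reaches.forLoop (T := s.nat 3 * 4 + 2) (by decide) h4
    (fun c s' => s'.flips = c * s.nat 3 ∧ ∀ u v, u < c → v < s.nat 3 →
        s'.mem 6 u v = if ω (u * s.nat 3 + v) then 1 else -1)
    ⟨by simpa [State.setNat] using hf, by simp⟩ ?_).mono le_rfl (fun s' _ h => h.2)
  rintro n s' _ hA h9 ⟨hfl, hS⟩
  have e3 : s'.nat 3 = s.nat 3 := hA.nat 3 (by decide)
  refine (Reaches.forLoop (T := 2) (by decide) ((hA.nat 4 (by decide)).trans h4)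
    (fun c s' => s'.flips = n * s.nat 3 + c ∧ ∀ u v, (u < n ∧ v < s.nat 3) ∨ (u = n ∧ v < c) →
        s'.mem 6 u v = if ω (u * s.nat 3 + v) then 1 else -1)
    ⟨by simpa [State.setNat] using hfl, ?_⟩ ?_).mono (by rw [e3]) ?_
  · rintro u v (h | h)
    · exact hS u v h.1 h.2
    · omega
  · rintro c s'' hc hA' h7 ⟨hfl', hS'⟩
    have e9 : s''.nat 9 = n := (hA'.nat 9 (by decide)).trans h9
    refine Reaches.block ⟨?_, fun u v huv => ?_⟩
    · simp [Instr.run, State.setReal, State.setMem, State.setNat, hfl', add_assoc]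
    · simp only [List.foldl, Instr.run, State.setReal, State.setMem, State.setNat, h7, e9, hfl',
        Function.update_self, true_and]
      by_cases h1 : u = n ∧ v = c
      · rw [if_pos h1, h1.1, h1.2]
      · rw [if_neg h1, hS' u v (by omega)]
  · rintro s'' _ ⟨hfl', hS'⟩
    refine ⟨by simp [State.setNat, hfl', e3, add_mul], fun u v hu hv => hS' u v ?_⟩
    rcases Nat.lt_succ_iff_lt_or_eq.mp hu with hu | hu
    · exact Or.inl ⟨hu, hv⟩
    · exact Or.inr ⟨hu, by rw [e3]; exact hv⟩

/-- The residual matrix after `p` rounds of the Cholesky decomposition. -/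
noncomputable def residual (A : ℕ → ℕ → ℝ) : ℕ → ℕ → ℕ → ℝ
  | 0 => A
  | p + 1 => fun u v => residual A p u v -
      residual A p u p / √(residual A p p p) * (residual A p v p / √(residual A p p p))

/-- Column number `p` of the Cholesky decomposition. -/
noncomputable def column (A : ℕ → ℕ → ℝ) (p u : ℕ) : ℝ :=
  residual A p u p / √(residual A p p p)

theorem reaches_roundProgram {s : State} (h4 : s.nat 4 = 1) (h5 : s.nat 5 = 0)
    (h9 : s.nat 9 < s.nat 0) (A : ℕ → ℕ → ℝ)
    (hA : ∀ u v, u < s.nat 0 → v < s.nat 0 → s.mem 2 u v = residual A (s.nat 9) u v) :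
    Reaches ω roundProgram s
      (s.nat 0 * 9 + s.nat 0 * (s.nat 0 * 8 + 4) + s.nat 0 * (s.nat 3 * 8 + 4) + 8)
      (fun s' => (∀ u v, u < s.nat 0 → v < s.nat 0 →
          s'.mem 2 u v = residual A (s.nat 9 + 1) u v) ∧
        ∀ u v, u < s.nat 0 → v < s.nat 3 → s'.mem 5 u v = s.mem 5 u v +
          column A (s.nat 9) u * s.mem 6 (s.nat 9) v) := by
  refine (Reaches.seq (Reaches.block (Q := fun s' =>
    s'.real 14 = √(residual A (s.nat 9) (s.nat 9) (s.nat 9))) ?_) ?_).mono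
    (T := 2 + ((s.nat 0 * 9 + 2) + ((s.nat 0 * (s.nat 0 * 8 + 4) + 2) +
      (s.nat 0 * (s.nat 3 * 8 + 4) + 2)))) (by omega) (fun s' _ h => h)
  · simp [Instr.run, State.setReal, hA _ _ h9 h9]
  intro s₁ hA₁ h14
  have n0 : s₁.nat 0 = s.nat 0 := hA₁.nat 0 (by decide)
  have n4 : s₁.nat 4 = 1 := (hA₁.nat 4 (by decide)).trans h4
  -- The inner bound is register 4, which holds 1, so this `fill` writes a single column. The copy
  -- in array 3 is needed because the next `fill` overwrites array 2.
  refine Reaches.seq (R := fun s' => ∀ u, u < s.nat 0 → s'.mem 3 u 0 = column A (s.nat 9) u)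
    ((Reaches.fill (T := 2) (by decide) n4 (fun u _ => column A (s.nat 9) u) ?_).mono
      (by rw [n0, n4]) ?_) ?_
  · intro u v s' hu _ hA' h6 h7 _
    rw [n0] at hu
    refine Reaches.block ?_
    have e9 : s'.nat 9 = s.nat 9 := (hA'.nat 9 (by decide)).trans (hA₁.nat 9 (by decide))
    have e14 := (hA'.real 14 (by decide)).trans h14
    have m2 : s'.mem 2 = s.mem 2 := (hA'.mem 2 (by decide)).trans (hA₁.mem 2 (by decide))
    simp [Instr.run, State.setReal, h6, e9, e14, m2, hA _ _ hu h9, column]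
  · intro s' _ h u hu
    rw [h u 0, if_pos ⟨by rw [n0]; exact hu, by rw [n4]; exact one_pos⟩]
  intro s₂ hA₂ hc
  have n0 : s₂.nat 0 = s.nat 0 := (hA₂.nat 0 (by decide)).trans n0
  have n4 : s₂.nat 4 = 1 := (hA₂.nat 4 (by decide)).trans n4
  have n5 : s₂.nat 5 = 0 := ((hA₂.nat 5 (by decide)).trans (hA₁.nat 5 (by decide))).trans h5
  have m2 : s₂.mem 2 = s.mem 2 := (hA₂.mem 2 (by decide)).trans (hA₁.mem 2 (by decide))
  refine Reaches.seq (R := fun s' => ∀ u v, u < s.nat 0 → v < s.nat 0 →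
    s'.mem 2 u v = residual A (s.nat 9 + 1) u v)
    ((Reaches.fill (T := 5) (by decide) n4 (residual A (s.nat 9 + 1)) ?_).mono
      (by rw [n0]) ?_) ?_
  · intro u v s' hu hv hA' h6 h7 hm
    rw [n0] at hu hv
    refine Reaches.block ?_
    have e5 : s'.nat 5 = 0 := (hA'.nat 5 (by decide)).trans n5
    have m3 : s'.mem 3 = s₂.mem 3 := hA'.mem 3 (by decide)
    simp [Instr.run, State.setReal, h6, h7, e5, m3, hm, m2, hA _ _ hu hv, hc u hu, hc v hv,
      residual, column]
  · intro s' _ h u v hu hv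
    rw [h u v, if_pos (by rw [n0]; exact ⟨hu, hv⟩)]
  intro s₃ hA₃ hr
  have n0 : s₃.nat 0 = s.nat 0 := (hA₃.nat 0 (by decide)).trans n0
  have n4 : s₃.nat 4 = 1 := (hA₃.nat 4 (by decide)).trans n4
  have n5 : s₃.nat 5 = 0 := (hA₃.nat 5 (by decide)).trans n5
  have n3 : s₃.nat 3 = s.nat 3 := ((hA₃.nat 3 (by decide)).trans (hA₂.nat 3 (by decide))).trans
    (hA₁.nat 3 (by decide))
  have n9 : s₃.nat 9 = s.nat 9 := ((hA₃.nat 9 (by decide)).trans (hA₂.nat 9 (by decide))).trans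
    (hA₁.nat 9 (by decide))
  have m3 : s₃.mem 3 = s₂.mem 3 := hA₃.mem 3 (by decide)
  have m5 : s₃.mem 5 = s.mem 5 := ((hA₃.mem 5 (by decide)).trans (hA₂.mem 5 (by decide))).trans
    (hA₁.mem 5 (by decide))
  have m6 : s₃.mem 6 = s.mem 6 := ((hA₃.mem 6 (by decide)).trans (hA₂.mem 6 (by decide))).trans
    (hA₁.mem 6 (by decide))
  refine (Reaches.fill (T := 5) (by decide) n4
    (fun u v => s.mem 5 u v + column A (s.nat 9) u * s.mem 6 (s.nat 9) v) ?_).mono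
      (by rw [n0, n3]) ?_
  · intro u v s' hu hv hA' h6 h7 hm
    rw [n0] at hu
    refine Reaches.block ?_
    have e5 : s'.nat 5 = 0 := (hA'.nat 5 (by decide)).trans n5
    have e9 : s'.nat 9 = s.nat 9 := (hA'.nat 9 (by decide)).trans n9
    have m3' : s'.mem 3 = s₂.mem 3 := (hA'.mem 3 (by decide)).trans m3
    have m6' : s'.mem 6 = s.mem 6 := (hA'.mem 6 (by decide)).trans m6
    simp [Instr.run, State.setReal, h6, h7, e5, e9, m3', m6', hm, m5, hc u hu]
  · intro s' hA' h
    refine ⟨fun u v hu hv => ?_, fun u v hu hv => ?_⟩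
    · rw [hA'.mem 2 (by decide), hr u v hu hv]
    · rw [h u v, if_pos (by rw [n0, n3]; exact ⟨hu, hv⟩)]

/-- Each column is multiplied by its row of signs and accumulated as soon as it is known, so the
Cholesky factor never has to be stored. -/
theorem reaches_rounds {s : State} (h4 : s.nat 4 = 1) (h5 : s.nat 5 = 0)
    (hm : s.mem 5 = fun _ _ => 0) (A : ℕ → ℕ → ℝ)
    (hA : ∀ u v, u < s.nat 0 → v < s.nat 0 → s.mem 2 u v = A u v) :
    Reaches ω (forLoop 9 0 roundProgram) s
      (s.nat 0 * (s.nat 0 * 9 + s.nat 0 * (s.nat 0 * 8 + 4) + s.nat 0 * (s.nat 3 * 8 + 4) + 10) + 2)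
      (fun s' => ∀ u v, u < s.nat 0 → v < s.nat 3 →
        s'.mem 5 u v = ∑ p ∈ Finset.range (s.nat 0), column A p u * s.mem 6 p v) := by
  refine (Reaches.forLoop (by decide) h4 (fun c s' =>
    (∀ u v, u < s.nat 0 → v < s.nat 0 → s'.mem 2 u v = residual A c u v) ∧
    ∀ u v, u < s.nat 0 → v < s.nat 3 →
        s'.mem 5 u v = ∑ p ∈ Finset.range c, column A p u * s.mem 6 p v)
    ⟨hA, by simp [State.setNat, hm]⟩ ?_).mono le_rfl (fun s' _ h => h.2)
  rintro n s' hn hA' h9 ⟨i1, i2⟩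
  have n0 : s'.nat 0 = s.nat 0 := hA'.nat 0 (by decide)
  have n3 : s'.nat 3 = s.nat 3 := hA'.nat 3 (by decide)
  have n4 : s'.nat 4 = 1 := (hA'.nat 4 (by decide)).trans h4
  have n5 : s'.nat 5 = 0 := (hA'.nat 5 (by decide)).trans h5
  have m6 : s'.mem 6 = s.mem 6 := hA'.mem 6 (by decide)
  refine (reaches_roundProgram n4 n5 (by rw [h9, n0]; exact hn) A
    (by rw [n0, h9]; exact i1)).mono (by rw [n0, n3]) ?_
  rintro s'' - ⟨j1, j2⟩
  rw [n0] at j1 j2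
  rw [h9] at j1 j2
  rw [n3] at j2
  refine ⟨j1, fun u v hu hv => ?_⟩
  rw [Finset.sum_range_succ, ← i2 u v hu hv, ← m6]
  exact j2 u v hu hv

theorem reaches_scaleProgram {s : State} (h4 : s.nat 4 = 1) (h3 : s.real 3 = 1) :
    Reaches ω scaleProgram s (s.nat 0 * (s.nat 3 * 5 + 4) + 7)
      (fun s' => ∀ u v, u < s.nat 0 → v < s.nat 3 →
        s'.mem 1 u v = s.mem 5 u v * √(1 / (s.nat 3 * (5 / 4)))) := by
  refine (Reaches.seq (U := s.nat 0 * (s.nat 3 * 5 + 4) + 2)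
    (Reaches.block (Q := fun s' => s'.real 14 = √(1 / (s.nat 3 * (5 / 4))))
    (by simp [Instr.run, State.setReal, h3])) ?_).mono
    (by simp only [List.length_cons, List.length_nil]; omega) (fun s' _ h => h)
  intro s₁ hA h14
  have n0 : s₁.nat 0 = s.nat 0 := hA.nat 0 (by decide)
  have n3 : s₁.nat 3 = s.nat 3 := hA.nat 3 (by decide)
  refine (Reaches.fill (T := 2) (by decide) ((hA.nat 4 (by decide)).trans h4)
    (fun u v => s.mem 5 u v * √(1 / (s.nat 3 * (5 / 4)))) ?_).mono (by rw [n0, n3]) ?_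
  · intro u v s' _ _ hA' h6 h7 _
    refine Reaches.block ?_
    have e14 := (hA'.real 14 (by decide)).trans h14
    have m5 : s'.mem 5 = s.mem 5 := (hA'.mem 5 (by decide)).trans (hA.mem 5 (by decide))
    simp only [List.foldl, Instr.run, State.setReal, h6, h7, m5]
    simp [e14]
  · intro s' _ h u v hu hv
    rw [h u v, if_pos (by rw [n0, n3]; exact ⟨hu, hv⟩)]

/-- The sign given by a coin. -/
def sign (b : Bool) : ℝ := if b then 1 else -1

/-- The output dimension of the random projection. -/
noncomputable def projectionDim (m : ℕ) (γ H δ : ℝ) : ℕ :=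
  ⌈200000 * (H + 1) * ⌈Real.logb 2 (m / δ)⌉₊ / γ ^ 2⌉₊

theorem reaches_projectionProgram {s : State} (h4 : s.nat 4 = 1) (h5 : s.nat 5 = 0)
    (h3 : s.real 3 = 1) (h1 : ∀ u v, s.mem 1 u v = if u = v ∧ u < s.nat 0 then 1 else 0)
    (hm5 : s.mem 5 = fun _ _ => 0) (hf : s.flips = 0) (hm : 0 < s.nat 0) (hγ : 0 < s.real 0)
    (hδ : 0 < s.real 2) {k l : ℕ} (hl : l = ⌈Real.logb 2 (s.nat 0 / s.real 2)⌉₊)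
    (hk : k = projectionDim (s.nat 0) (s.real 0) (s.real 1) (s.real 2)) :
    Reaches ω projectionProgram s ((3 * l + 3) + ((3 * k + 8) +
      ((s.nat 0 * (s.nat 0 * (6 * s.nat 1 + 11) + 4) + 6) + ((s.nat 0 * (k * 4 + 4) + 2) +
      ((s.nat 0 * (s.nat 0 * 9 + s.nat 0 * (s.nat 0 * 8 + 4) + s.nat 0 * (k * 8 + 4) + 10) + 2) +
      (s.nat 0 * (k * 5 + 4) + 7))))))
      (fun s' => s'.nat 3 = k ∧ ∀ u v, u < s.nat 0 → v < k → s'.mem 1 u v =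
        (∑ p ∈ Finset.range (s.nat 0), column (extendedKernel (inputKernel s) (s.real 1)) p u *
          sign (ω (p * k + v))) * √(1 / (k * (5 / 4)))) := by
  subst hl
  refine Reaches.seq (reaches_logProgram h3 hδ hm) fun s₁ hA₁ e5 => ?_
  have n0 : s₁.nat 0 = s.nat 0 := hA₁.nat 0 (by decide)
  have n1 : s₁.nat 1 = s.nat 1 := hA₁.nat 1 (by decide)
  have n2 : s₁.nat 2 = s.nat 2 := hA₁.nat 2 (by decide)
  have n4 : s₁.nat 4 = 1 := (hA₁.nat 4 (by decide)).trans h4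
  have n5 : s₁.nat 5 = 0 := (hA₁.nat 5 (by decide)).trans h5
  have r0 : s₁.real 0 = s.real 0 := hA₁.real 0 (by decide)
  have r1 : s₁.real 1 = s.real 1 := hA₁.real 1 (by decide)
  have r3 : s₁.real 3 = 1 := (hA₁.real 3 (by decide)).trans h3
  have m0 : s₁.mem 0 = s.mem 0 := hA₁.mem 0 (by decide)
  have m1 : s₁.mem 1 = s.mem 1 := hA₁.mem 1 (by decide)
  have m5 : s₁.mem 5 = s.mem 5 := hA₁.mem 5 (by decide)
  have f1 : s₁.flips = 0 := (hA₁.flips (by decide)).trans hf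
  have hk' : k = ⌈200000 * (s₁.real 1 + 1) * s₁.real 5 / s₁.real 0 ^ 2⌉₊ := by
    rw [hk, projectionDim, r0, r1, e5]
  refine Reaches.seq (R := fun s' => s'.nat 3 = k) ((reaches_dimProgram r3 n4
    (by rw [r0]; exact hγ)).mono (by rw [← hk']) (fun s' _ h => h.trans hk'.symm))
    fun s₂ hA₂ n3 => ?_
  replace n0 : s₂.nat 0 = s.nat 0 := (hA₂.nat 0 (by decide)).trans n0
  replace n1 : s₂.nat 1 = s.nat 1 := (hA₂.nat 1 (by decide)).trans n1
  replace n2 : s₂.nat 2 = s.nat 2 := (hA₂.nat 2 (by decide)).trans n2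
  replace n4 : s₂.nat 4 = 1 := (hA₂.nat 4 (by decide)).trans n4
  replace n5 : s₂.nat 5 = 0 := (hA₂.nat 5 (by decide)).trans n5
  replace r1 : s₂.real 1 = s.real 1 := (hA₂.real 1 (by decide)).trans r1
  replace r3 : s₂.real 3 = 1 := (hA₂.real 3 (by decide)).trans r3
  replace m0 : s₂.mem 0 = s.mem 0 := (hA₂.mem 0 (by decide)).trans m0
  replace m1 : s₂.mem 1 = s.mem 1 := (hA₂.mem 1 (by decide)).trans m1
  replace m5 : s₂.mem 5 = s.mem 5 := (hA₂.mem 5 (by decide)).trans m5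
  replace f1 : s₂.flips = 0 := (hA₂.flips (by decide)).trans f1
  have hK : inputKernel s₂ = inputKernel s := by
    funext u v
    simp only [inputKernel, n1, n2, m0]
  refine Reaches.seq (R := fun s' => ∀ u v, u < s.nat 0 → v < s.nat 0 →
      s'.mem 2 u v = extendedKernel (inputKernel s) (s.real 1) u v)
    ((reaches_kernelProgram n4 r3 (by rw [m1, n0]; exact h1)).mono (by rw [n0, n1])
      (fun s' _ h => by rw [n0, hK, r1] at h; exact h)) fun s₃ hA₃ e2 => ?_
  replace n0 : s₃.nat 0 = s.nat 0 := (hA₃.nat 0 (by decide)).trans n0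
  replace n3 : s₃.nat 3 = k := (hA₃.nat 3 (by decide)).trans n3
  replace n4 : s₃.nat 4 = 1 := (hA₃.nat 4 (by decide)).trans n4
  replace n5 : s₃.nat 5 = 0 := (hA₃.nat 5 (by decide)).trans n5
  replace r3 : s₃.real 3 = 1 := (hA₃.real 3 (by decide)).trans r3
  replace m5 : s₃.mem 5 = s.mem 5 := (hA₃.mem 5 (by decide)).trans m5
  replace f1 : s₃.flips = 0 := (hA₃.flips (by decide)).trans f1
  refine Reaches.seq (R := fun s' => ∀ u v, u < s.nat 0 → v < k →
      s'.mem 6 u v = sign (ω (u * k + v)))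
    ((reaches_signProgram n4 f1).mono (by rw [n0, n3])
      (fun s' _ h => by rw [n0, n3] at h; exact h)) fun s₄ hA₄ e6 => ?_
  replace n0 : s₄.nat 0 = s.nat 0 := (hA₄.nat 0 (by decide)).trans n0
  replace n3 : s₄.nat 3 = k := (hA₄.nat 3 (by decide)).trans n3
  replace n4 : s₄.nat 4 = 1 := (hA₄.nat 4 (by decide)).trans n4
  replace n5 : s₄.nat 5 = 0 := (hA₄.nat 5 (by decide)).trans n5
  replace r3 : s₄.real 3 = 1 := (hA₄.real 3 (by decide)).trans r3
  replace m5 : s₄.mem 5 = s.mem 5 := (hA₄.mem 5 (by decide)).trans m5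
  have m2 : s₄.mem 2 = s₃.mem 2 := hA₄.mem 2 (by decide)
  refine Reaches.seq (R := fun s' => ∀ u v, u < s.nat 0 → v < k → s'.mem 5 u v =
      ∑ p ∈ Finset.range (s.nat 0), column (extendedKernel (inputKernel s) (s.real 1)) p u *
        sign (ω (p * k + v)))
    ((reaches_rounds n4 n5 (m5.trans hm5) (extendedKernel (inputKernel s) (s.real 1))
      (by rw [n0, m2]; exact e2)).mono (by rw [n0, n3]) ?_) fun s₅ hA₅ e5 => ?_
  · intro s' _ h u v hu hv
    rw [n0, n3] at h
    rw [h u v hu hv]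
    refine Finset.sum_congr rfl fun p hp => ?_
    rw [e6 p v (Finset.mem_range.1 hp) hv]
  replace n0 : s₅.nat 0 = s.nat 0 := (hA₅.nat 0 (by decide)).trans n0
  replace n3 : s₅.nat 3 = k := (hA₅.nat 3 (by decide)).trans n3
  replace n4 : s₅.nat 4 = 1 := (hA₅.nat 4 (by decide)).trans n4
  replace r3 : s₅.real 3 = 1 := (hA₅.real 3 (by decide)).trans r3
  refine (reaches_scaleProgram n4 r3).mono (by rw [n0, n3]) fun s' hA' h => ?_
  rw [n0, n3] at h
  refine ⟨(hA'.nat 3 (by decide)).trans n3, fun u v hu hv => ?_⟩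
  rw [h u v hu hv, e5 u v hu hv]

/-- The initial states of the machine, up to what the preprocessing program needs. -/
structure IsInput (s : State) (m n : ℕ) (K : ℕ → ℕ → ℝ) (γ H δ : ℝ) : Prop where
  size : s.nat 0 = m
  width : s.nat 1 = n
  zero : s.nat 5 = 0
  margin : s.real 0 = γ
  loss : s.real 1 = H
  confidence : s.real 2 = δ
  mem_one : s.mem 1 = fun _ _ => 0
  mem_five : s.mem 5 = fun _ _ => 0
  flips : s.flips = 0
  kernel : inputKernel s = K

theorem preprocessing_time (m n k l : ℕ) :
    (3 * m + 5) + (3 + ((3 * l + 3) + ((3 * k + 8) +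
      ((m * (m * (6 * n + 11) + 4) + 6) + ((m * (k * 4 + 4) + 2) +
      ((m * (m * 9 + m * (m * 8 + 4) + m * (k * 8 + 4) + 10) + 2) +
      (m * (k * 5 + 4) + 7))))) + 1) + 1) ≤
    200 * ((m + 1) ^ 3 * (n + 1) * (k + 1) * (l + 1)) := by
  have h : ∀ a b c d, a ≤ (m + 1) ^ 3 → b ≤ n + 1 → c ≤ k + 1 → d ≤ l + 1 →
      a * b * c * d ≤ (m + 1) ^ 3 * (n + 1) * (k + 1) * (l + 1) := by
    intro a b c d ha hb hc hd
    gcongr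
  have m0 : 1 ≤ (m + 1) ^ 3 := Nat.one_le_pow _ _ (by omega)
  have m3 : m ^ 3 ≤ (m + 1) ^ 3 := Nat.pow_le_pow_left (by omega) 3
  have m2 : m ^ 2 ≤ (m + 1) ^ 3 := (Nat.pow_le_pow_left (by omega) 2).trans
    (Nat.pow_le_pow_right (by omega) (by omega))
  have m1 : m ≤ (m + 1) ^ 3 := (Nat.le_succ m).trans (Nat.le_self_pow (by omega) _)
  have n0 : 1 ≤ n + 1 := by omega
  have k0 : 1 ≤ k + 1 := by omega
  have l0 : 1 ≤ l + 1 := by omega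
  have n1 : n ≤ n + 1 := by omega
  have k1 : k ≤ k + 1 := by omega
  have l1 : l ≤ l + 1 := by omega
  -- The monomials of the step count are 1, l, k, m, m², m³, m²n, mk and m²k. Each is at most the
  -- product on the right, and their coefficients add up to less than 200.
  have a1 := h _ _ _ _ m0 n0 k0 l0
  have a2 := h _ _ _ _ m0 n0 k0 l1
  have a3 := h _ _ _ _ m0 n0 k1 l0
  have a4 := h _ _ _ _ m1 n0 k0 l0
  have a5 := h _ _ _ _ m2 n0 k0 l0
  have a6 := h _ _ _ _ m3 n0 k0 l0
  have a7 := h _ _ _ _ m2 n1 k0 l0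
  have a8 := h _ _ _ _ m1 n0 k1 l0
  have a9 := h _ _ _ _ m2 n0 k1 l0
  set X := (m + 1) ^ 3 * (n + 1) * (k + 1) * (l + 1)
  clear_value X
  nlinarith

theorem reaches_preprocessing {s : State} {m n : ℕ} {K : ℕ → ℕ → ℝ} {γ H δ : ℝ}
    (hs : IsInput s m n K γ H δ) (hγ : 0 < γ) (hδ : 0 < δ) (hc : 1 < m ∧ H < m * γ ^ 2)
    {k l : ℕ} (hl : l = ⌈Real.logb 2 (m / δ)⌉₊) (hk : k = projectionDim m γ H δ) :
    Reaches ω preprocessing s (200 * ((m + 1) ^ 3 * (n + 1) * (k + 1) * (l + 1)))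
      (fun s' => s'.nat 3 = k ∧ ∀ u v, u < m → v < k → s'.mem 1 u v =
        (∑ p ∈ Finset.range m, column (extendedKernel K H) p u *
          sign (ω (p * k + v))) * √(1 / (k * (5 / 4)))) := by
  obtain ⟨rfl, rfl, h5, rfl, rfl, rfl, hm1, hm5, hf, rfl⟩ := hs
  refine (Reaches.seq (reaches_identityProgram h5 hm1) ?_).mono
    (preprocessing_time (s.nat 0) (s.nat 1) k l) (fun s' _ h => h)
  rintro s₁ hA₁ ⟨h4, h3, -, h1⟩
  have n0 : s₁.nat 0 = s.nat 0 := hA₁.nat 0 (by decide)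
  refine Reaches.ite (fun _ => ?_) (fun h => absurd ?_ h)
  swap
  · change s₁.nat 4 < s₁.nat 0
    rw [h4, n0]
    exact hc.1
  refine Reaches.seq (Reaches.block (Q := fun s' => s'.real 5 = s.nat 0 * s.real 0 ^ 2) ?_) ?_
  · have r0 : s₁.real 0 = s.real 0 := hA₁.real 0 (by decide)
    simp [Instr.run, State.setReal, n0, r0, sq]
  intro s₂ hA₂ r5
  replace n0 : s₂.nat 0 = s.nat 0 := (hA₂.nat 0 (by decide)).trans n0
  have n1 : s₂.nat 1 = s.nat 1 := (hA₂.nat 1 (by decide)).trans (hA₁.nat 1 (by decide))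
  have n2 : s₂.nat 2 = s.nat 2 := (hA₂.nat 2 (by decide)).trans (hA₁.nat 2 (by decide))
  have n5 : s₂.nat 5 = s.nat 5 := (hA₂.nat 5 (by decide)).trans (hA₁.nat 5 (by decide))
  have r0 : s₂.real 0 = s.real 0 := (hA₂.real 0 (by decide)).trans (hA₁.real 0 (by decide))
  have r1 : s₂.real 1 = s.real 1 := (hA₂.real 1 (by decide)).trans (hA₁.real 1 (by decide))
  have r2 : s₂.real 2 = s.real 2 := (hA₂.real 2 (by decide)).trans (hA₁.real 2 (by decide))
  have m0 : s₂.mem 0 = s.mem 0 := (hA₂.mem 0 (by decide)).trans (hA₁.mem 0 (by decide))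
  have m1 : s₂.mem 1 = s₁.mem 1 := hA₂.mem 1 (by decide)
  have m5 : s₂.mem 5 = s.mem 5 := (hA₂.mem 5 (by decide)).trans (hA₁.mem 5 (by decide))
  have f2 : s₂.flips = s.flips := (hA₂.flips (by decide)).trans (hA₁.flips (by decide))
  have hK : inputKernel s₂ = inputKernel s := by
    funext u v
    simp only [inputKernel, n1, n2, m0]
  refine Reaches.ite (fun h => absurd ?_ (not_lt_of_ge h)) (fun _ => ?_)
  · rw [r5, r1]
    exact hc.2
  have := reaches_projectionProgram (ω := ω) (s := s₂) (k := k) (l := l) ((hA₂.nat 4 (by decide)).trans h4)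
    (n5.trans h5) ((hA₂.real 3 (by decide)).trans h3) (by rw [m1, n0]; exact h1)
    (m5.trans hm5) (f2.trans hf) (by rw [n0]; omega) (by rw [r0]; exact hγ)
    (by rw [r2]; exact hδ) (by rw [n0, r2]; exact hl) (by rw [n0, r0, r1, r2]; exact hk)
  rw [n0, n1, hK, r1] at this
  exact this

theorem reaches_preprocessing_of_not {s : State} {m n : ℕ} {K : ℕ → ℕ → ℝ} {γ H δ : ℝ}
    (hs : IsInput s m n K γ H δ) (hc : ¬ (1 < m ∧ H < m * γ ^ 2)) :
    Reaches ω preprocessing s (200 * (m + 1) ^ 3)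
      (fun s' => s'.nat 3 = m ∧ ∀ u v, u < m → v < m → s'.mem 1 u v = if u = v then 1 else 0) := by
  obtain ⟨rfl, rfl, h5, rfl, rfl, rfl, hm1, hm5, hf, rfl⟩ := hs
  refine (Reaches.seq (reaches_identityProgram h5 hm1) (U := 5) ?_).mono
    (by have : s.nat 0 + 1 ≤ (s.nat 0 + 1) ^ 3 := Nat.le_self_pow (by omega) _
        omega) (fun s' _ h => h)
  rintro s₁ hA₁ ⟨h4, h3, hk, h1⟩
  have hQ : ∀ u v, u < s.nat 0 → v < s.nat 0 → s₁.mem 1 u v = if u = v then 1 else 0 := by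
    intro u v hu hv
    rw [h1 u v]
    simp [hu]
  have n0 : s₁.nat 0 = s.nat 0 := hA₁.nat 0 (by decide)
  refine Reaches.ite (fun h => ?_) (fun _ => (Reaches.skip ⟨hk, hQ⟩).mono (by omega)
    (fun s' _ h => h))
  change s₁.nat 4 < s₁.nat 0 at h
  rw [h4, n0] at h
  refine Reaches.seq (U := 1) (Reaches.block (Q := fun s' => s'.real 5 = s.nat 0 * s.real 0 ^ 2)
    ?_) ?_
  · have r0 : s₁.real 0 = s.real 0 := hA₁.real 0 (by decide)
    simp [Instr.run, State.setReal, n0, r0, sq]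
  intro s₂ hA₂ r5
  have r1 : s₂.real 1 = s.real 1 := (hA₂.real 1 (by decide)).trans (hA₁.real 1 (by decide))
  have m1 : s₂.mem 1 = s₁.mem 1 := hA₂.mem 1 (by decide)
  refine Reaches.ite (fun _ => Reaches.skip ⟨(hA₂.nat 3 (by decide)).trans hk, ?_⟩)
    (fun h' => absurd ?_ h')
  · rw [m1]
    exact hQ
  · change s₂.real 5 ≤ s₂.real 1
    rw [r5, r1]
    exact not_lt.1 fun h' => hc ⟨h, h'⟩

/-- Through `inputKernel` both input formats lead to the same Gram matrix, so that a single
correctness proof covers them. -/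
theorem isInput_vectorInput {m d : ℕ} (x : Fin m → EuclideanSpace ℝ (Fin d)) (γ H δ : ℝ) :
    IsInput (vectorInput x γ H δ) m d
      (ofArray fun i j : Fin m => inner ℝ (x i) (x j)) γ H δ where
  size := rfl
  width := rfl
  zero := rfl
  margin := rfl
  loss := rfl
  confidence := rfl
  mem_one := rfl
  mem_five := rfl
  flips := rfl
  kernel := by
    funext u v
    have e2 : (vectorInput x γ H δ).nat 2 = 0 := rfl
    have e1 : (vectorInput x γ H δ).nat 1 = d := rfl
    have e0 : (vectorInput x γ H δ).mem 0 = ofArray fun i j => x i j := rfl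
    rw [inputKernel, if_pos e2, e1, e0]
    by_cases h : u < m ∧ v < m
    · rw [ofArray, dif_pos h, Finset.sum_range, PiLp.inner_apply]
      simp [ofArray, h, mul_comm]
    · rw [ofArray, dif_neg h]
      refine Finset.sum_eq_zero fun t _ => ?_
      by_cases hu : u < m
      · have hv : ¬ v < m := fun hv => h ⟨hu, hv⟩
        simp [ofArray, hv]
      · simp [ofArray, hu]

theorem isInput_kernelInput {m : ℕ} (K : Matrix (Fin m) (Fin m) ℝ) (γ H δ : ℝ) :
    IsInput (kernelInput K γ H δ) m m (ofArray fun i j : Fin m => K i j) γ H δ where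
  size := rfl
  width := rfl
  zero := rfl
  margin := rfl
  loss := rfl
  confidence := rfl
  mem_one := rfl
  mem_five := rfl
  flips := rfl
  kernel := rfl

/-! ### Random projections -/

/-- The signed sum of the entries of `a`. -/
def signedSum {n : ℕ} (a : Fin n → ℝ) (σ : Fin n → Bool) : ℝ :=
  ∑ i, sign (σ i) * a i

theorem sum_cons_signs {n : ℕ} (f : (Fin (n + 1) → Bool) → ℝ) :
    ∑ σ, f σ = ∑ σ : Fin n → Bool, (f (Fin.cons true σ) + f (Fin.cons false σ)) := by
  rw [← (Fin.consEquiv fun _ : Fin (n + 1) => Bool).sum_comp, Fintype.sum_prod_type,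
    Fintype.sum_bool, ← Finset.sum_add_distrib]
  rfl

theorem signedSum_cons {n : ℕ} (a : Fin (n + 1) → ℝ) (b : Bool) (σ : Fin n → Bool) :
    signedSum a (Fin.cons b σ) = sign b * a 0 + signedSum (fun i => a i.succ) σ := by
  simp only [signedSum, Fin.sum_univ_succ]
  rfl

/-- Distinct signs are uncorrelated, so only the diagonal terms survive. Expectations are written as
sums over all 2^n sign vectors. -/
theorem sum_signedSum_mul {n : ℕ} (a b : Fin n → ℝ) :
    ∑ σ, signedSum a σ * signedSum b σ = 2 ^ n * ∑ i, a i * b i := by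
  induction n with
  | zero => simp [signedSum]
  | succ n ih =>
    rw [sum_cons_signs]
    have : ∀ σ : Fin n → Bool,
        signedSum a (Fin.cons true σ) * signedSum b (Fin.cons true σ) +
          signedSum a (Fin.cons false σ) * signedSum b (Fin.cons false σ) =
        2 * (a 0 * b 0) + 2 * (signedSum (fun i => a i.succ) σ *
          signedSum (fun i => b i.succ) σ) := by
      intro σ
      simp only [signedSum_cons, sign, if_true, Bool.false_eq_true, if_false]
      ring
    rw [Finset.sum_congr rfl fun σ _ => this σ, Finset.sum_add_distrib, Finset.sum_const,
      ← Finset.mul_sum, ih, Fin.sum_univ_succ]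
    simp
    ring

/-- Summation over the sign of one coordinate turns the cross term 2tas into a hyperbolic cosine.
The estimate cosh y ≤ exp(y²/2) trades it for a larger coefficient of s², which prepares an
induction over the coordinates. -/
theorem exp_add_exp_le (t a s : ℝ) :
    Real.exp (t * (1 * a + s) ^ 2) + Real.exp (t * (-1 * a + s) ^ 2) ≤
      2 * Real.exp (t * a ^ 2) * Real.exp ((t + 2 * t ^ 2 * a ^ 2) * s ^ 2) := by
  have h := Real.cosh_le_exp_half_sq (2 * t * a * s)
  rw [Real.cosh_eq] at h
  calc _ = 2 * Real.exp (t * a ^ 2) * Real.exp (t * s ^ 2) *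
        ((Real.exp (2 * t * a * s) + Real.exp (-(2 * t * a * s))) / 2) := by
        have e1 : t * (1 * a + s) ^ 2 = t * a ^ 2 + t * s ^ 2 + 2 * t * a * s := by ring
        have e2 : t * (-1 * a + s) ^ 2 = t * a ^ 2 + t * s ^ 2 + -(2 * t * a * s) := by ring
        rw [e1, e2]
        simp only [Real.exp_add]
        ring
    _ ≤ 2 * Real.exp (t * a ^ 2) * Real.exp (t * s ^ 2) *
        Real.exp ((2 * t * a * s) ^ 2 / 2) := by gcongr
    _ = _ := by
        rw [mul_assoc, ← Real.exp_add]
        congr 2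
        ring

/-- The coefficient t grows by 2t²c whenever a coordinate with square c is removed. The hypothesis
on `T` is an invariant of this process and keeps the coefficient below `T` throughout. -/
theorem sum_exp_mul_signedSum_sq_le {n : ℕ} (a : Fin n → ℝ) {t T : ℝ} (ht : 0 ≤ t)
    (hT0 : 0 ≤ T) (hT : t * (1 + 2 * (∑ i, a i ^ 2) * T) ≤ T) :
    ∑ σ, Real.exp (t * signedSum a σ ^ 2) ≤ 2 ^ n * Real.exp (T * ∑ i, a i ^ 2) := by
  induction n generalizing t with
  | zero => simp [signedSum]
  | succ n ih =>
    have hA : 0 ≤ ∑ i : Fin n, a i.succ ^ 2 := Finset.sum_nonneg fun i _ => sq_nonneg _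
    rw [Fin.sum_univ_succ] at hT ⊢
    set A := ∑ i : Fin n, a i.succ ^ 2 with hAdef
    set c := a 0 ^ 2 with hc
    have hc0 : 0 ≤ c := sq_nonneg _
    have hTn : t ≤ T := by
      have : 0 ≤ t * (2 * (c + A) * T) := by positivity
      linarith
    -- Preservation of the invariant: t(1+2AT) ≤ T(1-2ct), and multiplication by 1+2ct gives at most
    -- T(1-(2ct)²).
    have h2 : (t + 2 * t ^ 2 * c) * (1 + 2 * A * T) ≤ T := by
      have h3 : t * (1 + 2 * A * T) ≤ T * (1 - 2 * c * t) := by linarith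
      have h4 : 0 ≤ 1 + 2 * t * c := by positivity
      have h5 := mul_le_mul_of_nonneg_right h3 h4
      have h6 : 0 ≤ T * (2 * c * t) ^ 2 := by positivity
      nlinarith
    rw [sum_cons_signs]
    calc _ ≤ ∑ σ : Fin n → Bool, 2 * Real.exp (t * c) *
          Real.exp ((t + 2 * t ^ 2 * c) * signedSum (fun i => a i.succ) σ ^ 2) := by
          refine Finset.sum_le_sum fun σ _ => ?_
          simpa only [signedSum_cons, sign, if_true, Bool.false_eq_true, if_false] using
            exp_add_exp_le t (a 0) (signedSum (fun i => a i.succ) σ)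
      _ = 2 * Real.exp (t * c) * ∑ σ : Fin n → Bool,
          Real.exp ((t + 2 * t ^ 2 * c) * signedSum (fun i => a i.succ) σ ^ 2) := by
          rw [Finset.mul_sum]
      _ ≤ 2 * Real.exp (T * c) * (2 ^ n * Real.exp (T * A)) := by
          gcongr
          exact ih _ (by positivity) h2
      _ = _ := by
          rw [mul_add, Real.exp_add, pow_succ]
          ring

theorem sum_exp_quarter_signedSum_sq_le {n : ℕ} (a : Fin n → ℝ) (ha : ∑ i, a i ^ 2 ≤ 1) :
    ∑ σ, Real.exp (1 / 4 * signedSum a σ ^ 2) ≤ 2 ^ n * 2 := by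
  refine (sum_exp_mul_signedSum_sq_le a (T := 1 / 2) (by norm_num) (by norm_num) (by linarith)).trans ?_
  gcongr
  have h : Real.exp (1 / 2 * ∑ i, a i ^ 2) ≤ Real.exp (1 / 2) := by
    gcongr
    linarith
  refine h.trans ?_
  have h1 : Real.exp (1 / 2) ^ 2 ≤ 2 ^ 2 := by
    rw [← Real.exp_nat_mul]
    have := Real.exp_one_lt_d9
    norm_num at this ⊢
    linarith
  exact le_of_sq_le_sq h1 (by norm_num)

theorem exp_le_one_add_add_sq_mul (x : ℝ) : Real.exp x ≤ 1 + x + x ^ 2 * Real.exp |x| := by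
  have h1 : 1 ≤ Real.exp |x| := Real.one_le_exp (abs_nonneg x)
  have h2 : x ^ 2 ≤ x ^ 2 * Real.exp |x| := le_mul_of_one_le_right (sq_nonneg x) h1
  rcases le_or_gt |x| 1 with h | h
  · have := (abs_le.1 (Real.abs_exp_sub_one_sub_id_le h)).2
    linarith
  · rcases lt_abs.1 h with h' | h'
    · rw [abs_of_pos (by linarith)]
      have : 1 * Real.exp x ≤ x ^ 2 * Real.exp x := by
        gcongr
        nlinarith
      linarith
    · have : Real.exp x ≤ 1 := Real.exp_le_one_iff.2 (by linarith)
      nlinarith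

/-- The second-order remainder is lam² y² exp|lam y| with y = sv - μ. Both factors y² and exp|lam y|
are absorbed into exp(|y|/4); then |y| ≤ (s²+v²)/2 + 1 and the inequality between arithmetic and
geometric mean separate s from v. What remains has bounded mean by
`sum_exp_quarter_signedSum_sq_le`. -/
theorem exp_mul_deviation_le {s v μ lam : ℝ} (hμ : |μ| ≤ 1) (hlam : |lam| ≤ 1 / 8) :
    Real.exp (lam * (s * v - μ)) ≤ 1 + lam * (s * v - μ) + lam ^ 2 * (128 *
      (Real.exp (1 / 4 * s ^ 2) + Real.exp (1 / 4 * v ^ 2))) := by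
  refine (exp_le_one_add_add_sq_mul _).trans ?_
  rw [mul_pow, mul_assoc]
  refine add_le_add le_rfl (mul_le_mul_of_nonneg_left ?_ (sq_nonneg _))
  set y := s * v - μ
  have hy : |y| ≤ (s ^ 2 + v ^ 2) / 2 + 1 := by
    have h1 : |s * v| ≤ (s ^ 2 + v ^ 2) / 2 := by
      rw [abs_le]
      constructor <;> nlinarith [sq_nonneg (s + v), sq_nonneg (s - v)]
    exact (abs_sub _ _).trans (add_le_add h1 hμ)
  -- The constant 128 = 2 · 8² comes from z²/2 ≤ exp z at z = |y|/8.
  have h1 : y ^ 2 ≤ 128 * Real.exp (|y| / 8) := by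
    have := Real.quadratic_le_exp_of_nonneg (x := |y| / 8) (by positivity)
    have h2 := sq_abs y
    have h3 := abs_nonneg y
    nlinarith
  have h2 : Real.exp |lam * y| ≤ Real.exp (|y| / 8) := by
    gcongr
    rw [abs_mul]
    have := abs_nonneg y
    nlinarith
  have h3 : Real.exp (1 / 4) ≤ 2 := by
    have h : Real.exp (1 / 4) ≤ Real.exp (1 / 2) := by
      gcongr
      norm_num
    have h1 : Real.exp (1 / 2) ^ 2 ≤ 2 ^ 2 := by
      rw [← Real.exp_nat_mul]
      have := Real.exp_one_lt_d9
      norm_num at this ⊢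
      linarith
    exact h.trans (le_of_sq_le_sq h1 (by norm_num))
  have h4 : Real.exp (1 / 8 * s ^ 2) * Real.exp (1 / 8 * v ^ 2) ≤
      (Real.exp (1 / 4 * s ^ 2) + Real.exp (1 / 4 * v ^ 2)) / 2 := by
    have e : ∀ z : ℝ, Real.exp (1 / 4 * z ^ 2) = Real.exp (1 / 8 * z ^ 2) ^ 2 := by
      intro z
      rw [← Real.exp_nat_mul]
      congr 1
      push_cast
      ring
    rw [e, e]
    nlinarith [sq_nonneg (Real.exp (1 / 8 * s ^ 2) - Real.exp (1 / 8 * v ^ 2))]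
  calc y ^ 2 * Real.exp |lam * y| ≤ 128 * Real.exp (|y| / 8) * Real.exp (|y| / 8) := by gcongr
    _ = 128 * Real.exp (|y| / 4) := by
        rw [mul_assoc, ← Real.exp_add]
        congr 2
        ring
    _ ≤ 128 * Real.exp (1 / 4 + (1 / 8 * s ^ 2 + 1 / 8 * v ^ 2)) := by
        gcongr
        linarith
    _ = 128 * (Real.exp (1 / 4) * (Real.exp (1 / 8 * s ^ 2) * Real.exp (1 / 8 * v ^ 2))) := by
        rw [Real.exp_add, Real.exp_add]
    _ ≤ 128 * (2 * ((Real.exp (1 / 4 * s ^ 2) + Real.exp (1 / 4 * v ^ 2)) / 2)) := by gcongr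
    _ = _ := by ring

/-- The linear term averages to zero by `sum_signedSum_mul`, and the two exponentials average to at
most 2 each, whence 512 = 128 · (2 + 2). -/
theorem sum_exp_deviation_le {n : ℕ} {a b : Fin n → ℝ} (ha : ∑ i, a i ^ 2 ≤ 1)
    (hb : ∑ i, b i ^ 2 ≤ 1) {lam : ℝ} (hlam : |lam| ≤ 1 / 8) :
    ∑ σ, Real.exp (lam * (signedSum a σ * signedSum b σ - ∑ i, a i * b i)) ≤
      2 ^ n * Real.exp (512 * lam ^ 2) := by
  set μ := ∑ i, a i * b i with hμdef
  have hμ : |μ| ≤ 1 := by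
    rw [← sq_le_one_iff_abs_le_one]
    refine (Finset.sum_mul_sq_le_sq_mul_sq _ _ _).trans ?_
    exact mul_le_one₀ ha (Finset.sum_nonneg fun i _ => sq_nonneg _) hb
  calc _ ≤ ∑ σ, (1 + lam * (signedSum a σ * signedSum b σ - μ) + lam ^ 2 * (128 *
        (Real.exp (1 / 4 * signedSum a σ ^ 2) + Real.exp (1 / 4 * signedSum b σ ^ 2)))) :=
        Finset.sum_le_sum fun σ _ => exp_mul_deviation_le hμ hlam
    _ = 2 ^ n + lam * (∑ σ, signedSum a σ * signedSum b σ - 2 ^ n * μ) + lam ^ 2 * (128 *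
        (∑ σ, Real.exp (1 / 4 * signedSum a σ ^ 2) +
          ∑ σ, Real.exp (1 / 4 * signedSum b σ ^ 2))) := by
        simp only [Finset.sum_add_distrib, ← Finset.mul_sum, Finset.sum_sub_distrib]
        simp
    _ ≤ 2 ^ n + lam * (2 ^ n * μ - 2 ^ n * μ) + lam ^ 2 * (128 * (2 ^ n * 2 + 2 ^ n * 2)) := by
        rw [sum_signedSum_mul]
        gcongr
        · exact sum_exp_quarter_signedSum_sq_le a ha
        · exact sum_exp_quarter_signedSum_sq_le b hb
    _ = 2 ^ n * (512 * lam ^ 2 + 1) := by ring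
    _ ≤ _ := by
        gcongr
        exact Real.add_one_le_exp _

/-- A tail bound for the random projection of an inner product. -/
theorem card_deviation_le {n k : ℕ} {a b : Fin n → ℝ} (ha : ∑ i, a i ^ 2 ≤ 1)
    (hb : ∑ i, b i ^ 2 ≤ 1) {ε : ℝ} (h0 : 0 ≤ ε) (h1 : ε ≤ 1) :
    ((Finset.univ.filter fun τ : Fin k → Fin n → Bool =>
      k * ε ≤ ∑ j, (signedSum a (τ j) * signedSum b (τ j) - ∑ i, a i * b i)).card : ℝ) ≤
      (2 ^ n) ^ k * Real.exp (-(k * ε ^ 2 / 2048)) := by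
  set μ := ∑ i, a i * b i
  -- The minimizer of 512 lam² - lam ε; the minimum is -ε²/2048.
  set lam := ε / 1024 with hlam
  have hl : |lam| ≤ 1 / 8 := by
    rw [hlam, abs_of_nonneg (by positivity)]
    linarith
  calc _ ≤ ∑ τ : Fin k → Fin n → Bool, Real.exp (-(lam * (k * ε))) *
        ∏ j, Real.exp (lam * (signedSum a (τ j) * signedSum b (τ j) - μ)) := by
        rw [Finset.card_filter, Nat.cast_sum]
        refine Finset.sum_le_sum fun τ _ => ?_
        rw [← Real.exp_sum, ← Finset.mul_sum, ← Real.exp_add]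
        split_ifs with h
        · rw [Nat.cast_one]
          refine Real.one_le_exp ?_
          have : 0 ≤ lam := by positivity
          nlinarith [mul_le_mul_of_nonneg_left h this]
        · rw [Nat.cast_zero]
          positivity
    _ = Real.exp (-(lam * (k * ε))) *
        (∑ σ, Real.exp (lam * (signedSum a σ * signedSum b σ - μ))) ^ k := by
        rw [← Finset.mul_sum, Fintype.sum_pow]
    _ ≤ Real.exp (-(lam * (k * ε))) * (2 ^ n * Real.exp (512 * lam ^ 2)) ^ k := by
        gcongr
        exact sum_exp_deviation_le ha hb hl
    _ = _ := by
        rw [mul_pow, ← Real.exp_nat_mul, mul_left_comm, ← Real.exp_add]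
        congr 2
        rw [hlam]
        ring

/-- The coins that a run of the projection program uses, as a matrix. -/
def coinMatrix (n k : ℕ) (ω : ℕ → Bool) (j : Fin k) (p : Fin n) : Bool :=
  ω (p * k + j)

instance : IsProbabilityMeasure coins := by
  unfold coins
  infer_instance

/-- The positions p·k + j enumerate the first n·k coins without repetition, so the event lies in a
cylinder that prescribes n·k coins. An upper bound suffices, as only failure probabilities are
estimated this way. -/
theorem coins_coinMatrix_eq_le {n k : ℕ} (τ : Fin k → Fin n → Bool) :
    coins {ω | coinMatrix n k ω = τ} ≤ ENNReal.ofReal (1 / (2 ^ n) ^ k) := by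
  classical
  let c : ℕ → Bool := fun x => if h : x < n * k then
    τ (finProdFinEquiv.symm ⟨x, h⟩).2 (finProdFinEquiv.symm ⟨x, h⟩).1 else false
  have hsub : {ω | coinMatrix n k ω = τ} ⊆
      Set.pi (Finset.range (n * k) : Set ℕ) fun x => {c x} := by
    intro ω hω x hx
    have hx' : x < n * k := by simpa using hx
    simp only [Set.mem_singleton_iff, c, dif_pos hx']
    rw [← (hω : coinMatrix n k ω = τ), coinMatrix]
    congr 1
    have h : _ = x := congrArg Fin.val
      (finProdFinEquiv.apply_symm_apply (⟨x, hx'⟩ : Fin (n * k)))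
    rw [finProdFinEquiv_apply_val] at h
    linarith
  refine (measure_mono hsub).trans ?_
  have hp : ∀ b : Bool, (PMF.uniformOfFintype Bool).toMeasure {b} = ENNReal.ofReal (1 / 2) := by
    intro b
    rw [PMF.toMeasure_apply_singleton _ _ (measurableSet_singleton b), PMF.uniformOfFintype_apply]
    rw [Fintype.card_bool, one_div, ENNReal.ofReal_inv_of_pos two_pos]
    simp
  rw [coins, Measure.infinitePi_pi _ fun _ _ => measurableSet_singleton _]
  simp only [hp]
  rw [Finset.prod_const, Finset.card_range, ← ENNReal.ofReal_pow (by norm_num)]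
  apply le_of_eq
  rw [one_div_pow, pow_mul]

theorem coins_coinMatrix_le {n k : ℕ} (S : Finset (Fin k → Fin n → Bool)) :
    coins {ω | coinMatrix n k ω ∈ S} ≤ ENNReal.ofReal (S.card / (2 ^ n) ^ k) := by
  have hU : {ω | coinMatrix n k ω ∈ S} = ⋃ τ ∈ S, {ω | coinMatrix n k ω = τ} := by
    ext ω
    simp
  rw [hU]
  refine (measure_biUnion_finset_le _ _).trans ((Finset.sum_le_sum fun τ _ =>
    coins_coinMatrix_eq_le τ).trans ?_)
  rw [Finset.sum_const, nsmul_eq_mul,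
    div_eq_mul_one_div (S.card : ℝ),
    ENNReal.ofReal_mul (Nat.cast_nonneg _), ENNReal.ofReal_natCast]

theorem measurableSet_coinMatrix {n k : ℕ} (S : Set (Fin k → Fin n → Bool)) :
    MeasurableSet {ω | coinMatrix n k ω ∈ S} := by
  have : Measurable (coinMatrix n k) :=
    measurable_pi_lambda _ fun j => measurable_pi_lambda _ fun p => measurable_pi_apply _
  exact this (Set.toFinite S).measurableSet

/-! ### Correctness of the Cholesky decomposition -/

section Gram

variable {F G : Type*} [NormedAddCommGroup F] [InnerProductSpace ℝ F]
  [NormedAddCommGroup G] [InnerProductSpace ℝ G]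

/-- A Cholesky round is a Gram–Schmidt step: every vector loses its component along the current `z
p`, and `z p` itself becomes zero. Hence every pivot is a squared norm, and after m rounds nothing
is left. -/
theorem exists_residual_eq_inner {A : ℕ → ℕ → ℝ} {m : ℕ} (x : ℕ → F)
    (hA : ∀ u v, u < m → v < m → A u v = inner ℝ (x u) (x v)) (p : ℕ) (hp : p ≤ m) :
    ∃ z : ℕ → F, (∀ u v, u < m → v < m → residual A p u v = inner ℝ (z u) (z v)) ∧
      ∀ q < p, z q = 0 := by
  induction p with
  | zero => exact ⟨x, hA, by simp⟩
  | succ p ih =>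
    obtain ⟨z, hz, h0⟩ := ih (by omega)
    refine ⟨fun u => z u - (inner ℝ (z u) (z p) / ‖z p‖ ^ 2) • z p, fun u v hu hv => ?_,
      fun q hq => ?_⟩
    · simp only [residual]
      rw [hz u v hu hv, hz u p hu hp, hz v p hv hp, hz p p hp hp,
        real_inner_self_eq_norm_sq, Real.sqrt_sq (norm_nonneg _)]
      -- For a zero pivot the quotient by zero is 0, so the round changes nothing; this is correct,
      -- since `z p` is already zero.
      by_cases h : z p = 0
      · simp [h]
      · have h' : ‖z p‖ ≠ 0 := norm_ne_zero_iff.2 h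
        rw [inner_sub_left, inner_sub_right, inner_sub_right, inner_smul_left, inner_smul_right,
          inner_smul_left, inner_smul_right, real_inner_self_eq_norm_sq,
          real_inner_comm (z v) (z p)]
        simp only [conj_trivial]
        field_simp
        ring
    · rcases Nat.lt_succ_iff_lt_or_eq.1 hq with hq | rfl
      · simp [h0 q hq]
      · by_cases h : z q = 0
        · simp [h]
        · have h' : ‖z q‖ ≠ 0 := norm_ne_zero_iff.2 h
          simp [h']

theorem eq_residual_add_sum_column (A : ℕ → ℕ → ℝ) (p u v : ℕ) :
    A u v = residual A p u v + ∑ q ∈ Finset.range p, column A q u * column A q v := by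
  induction p with
  | zero => simp [residual]
  | succ p ih =>
    rw [ih, Finset.sum_range_succ, residual, column, column]
    ring

/-- The Cholesky decomposition of a Gram matrix. -/
theorem sum_column_mul_column {A : ℕ → ℕ → ℝ} {m : ℕ} (x : ℕ → F)
    (hA : ∀ u v, u < m → v < m → A u v = inner ℝ (x u) (x v)) {u v : ℕ} (hu : u < m)
    (hv : v < m) : ∑ q ∈ Finset.range m, column A q u * column A q v = inner ℝ (x u) (x v) := by
  obtain ⟨z, hz, h0⟩ := exists_residual_eq_inner x hA m le_rfl
  rw [← hA u v hu hv, eq_residual_add_sum_column A m u v, hz u v hu hv, h0 u hu]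
  simp

/-- Linear functionals can be transferred between families with the same Gram matrix. -/
theorem exists_inner_eq_of_gram_eq {ι : Type*} [Fintype ι] {x : ι → F} {z : ι → G}
    (h : ∀ i j, inner ℝ (x i) (x j) = inner ℝ (z i) (z j)) (u : F) :
    ∃ w : G, ‖w‖ ≤ ‖u‖ ∧ ∀ i, inner ℝ w (z i) = inner ℝ u (x i) := by
  have : FiniteDimensional ℝ (Submodule.span ℝ (Set.range x)) :=
    FiniteDimensional.span_of_finite ℝ (Set.finite_range x)
  set S := Submodule.span ℝ (Set.range x) with hS
  -- Only the projection of `u` to the span of the `x i` matters. The combination of the `z i` with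
  -- the same coefficients works, because norms and inner products of combinations depend only on
  -- the Gram matrix.
  obtain ⟨c, hc⟩ := (Submodule.mem_span_range_iff_exists_fun ℝ).1
    (S.starProjection_apply_mem u)
  have hnorm : ‖∑ i, c i • z i‖ = ‖S.starProjection u‖ := by
    rw [← hc, ← sq_eq_sq₀ (norm_nonneg _) (norm_nonneg _), ← real_inner_self_eq_norm_sq,
      ← real_inner_self_eq_norm_sq]
    simp only [sum_inner, inner_sum, inner_smul_left, inner_smul_right, h]
  refine ⟨∑ i, c i • z i, ?_, fun i => ?_⟩
  · rw [hnorm]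
    exact S.norm_starProjection_apply_le u
  · have h1 : inner ℝ (u - S.starProjection u) (x i) = 0 :=
      Submodule.starProjection_inner_eq_zero u (x i)
        (Submodule.subset_span (Set.mem_range_self i))
    rw [inner_sub_left, sub_eq_zero] at h1
    rw [h1, ← hc]
    simp only [sum_inner, inner_smul_left, h]

end Gram

/-! ### Extended points -/

section Extended

variable {E : Type*} [NormedAddCommGroup E] [InnerProductSpace ℝ E] {m : ℕ}

/-- The point `x i`, extended by a multiple of a unit vector. -/
noncomputable def extendedPoint (x : Fin m → E) (H : ℝ) (i : Fin m) :
    WithLp 2 (E × EuclideanSpace ℝ (Fin m)) :=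
  WithLp.toLp 2 (√(1 / (1 + √H)) • x i, √(1 - 1 / (1 + √H)) • EuclideanSpace.single i 1)

theorem one_div_one_add_sqrt_le (H : ℝ) : 1 / (1 + √H) ≤ 1 := by
  rw [div_le_one (by positivity)]
  linarith [Real.sqrt_nonneg H]

theorem inner_extendedPoint (x : Fin m → E) (H : ℝ) (i j : Fin m) :
    inner ℝ (extendedPoint x H i) (extendedPoint x H j) =
      inner ℝ (x i) (x j) * (1 / (1 + √H)) +
        (if i = j then 1 else 0) * (1 - 1 / (1 + √H)) := by
  have h1 : 0 ≤ 1 / (1 + √H) := by positivity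
  have h2 : 0 ≤ 1 - 1 / (1 + √H) := sub_nonneg.2 (one_div_one_add_sqrt_le H)
  rw [extendedPoint, extendedPoint, WithLp.prod_inner_apply]
  simp only [inner_smul_left, inner_smul_right, conj_trivial, EuclideanSpace.inner_single_left]
  rw [← mul_assoc, Real.mul_self_sqrt h1, ← mul_assoc, Real.mul_self_sqrt h2]
  simp only [one_mul, PiLp.single_apply]
  ring

theorem norm_extendedPoint_le {x : Fin m → E} (hx : ∀ i, ‖x i‖ ≤ 1) (H : ℝ) (i : Fin m) :
    ‖extendedPoint x H i‖ ≤ 1 := by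
  have h1 : 0 ≤ 1 / (1 + √H) := by positivity
  rw [← sq_le_one_iff₀ (norm_nonneg _), ← real_inner_self_eq_norm_sq, inner_extendedPoint,
    real_inner_self_eq_norm_sq, if_pos rfl]
  have := mul_le_mul_of_nonneg_right ((sq_le_one_iff₀ (norm_nonneg _)).2 (hx i)) h1
  linarith

theorem separable_extendedPoint {x : Fin m → E} {L : Fin m → ℝ} (hL : ∀ i, L i = 1 ∨ L i = -1)
    {γ H : ℝ} (hH : 0 ≤ H) {w : E} (hw : ‖w‖ ≤ 1) (hloss : squaredHingeLoss γ x L w ≤ H) :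
    SeparableWithMargin (extendedPoint x H) L (γ / (1 + √H)) := by
  set ξ : Fin m → ℝ := fun i => max 0 (γ - L i * inner ℝ w (x i)) with hξ
  have hr : 0 < 1 + √H := by positivity
  have hr' : 0 < √(1 + √H) := Real.sqrt_pos.2 hr
  have hLL : ∀ i, L i * L i = 1 := by
    intro i
    rcases hL i with h | h <;> rw [h] <;> norm_num
  have e1 : √(1 / (1 + √H)) = 1 / √(1 + √H) := by
    rw [Real.sqrt_div zero_le_one, Real.sqrt_one]
  have e2 : √(1 - 1 / (1 + √H)) = √√H / √(1 + √H) := by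
    rw [← Real.sqrt_div (Real.sqrt_nonneg H)]
    congr 1
    field_simp
    ring
  -- The weight H^(-1/4) of the slacks makes their squares sum to at most √H. It also cancels
  -- against the weight √(1-θ) = H^(1/4)/√(1+√H) of the private coordinate, so that exactly ξ_i is
  -- added to L_i⟨w, x_i⟩.
  refine ⟨(1 / √(1 + √H)) • WithLp.toLp 2 (w, WithLp.toLp 2 fun i => L i * ξ i / √√H), ?_, ?_⟩
  · rw [norm_smul, Real.norm_of_nonneg (by positivity), one_div, inv_mul_le_iff₀ hr', mul_one]
    refine Real.le_sqrt_of_sq_le ?_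
    rw [WithLp.prod_norm_sq_eq_of_L2, EuclideanSpace.norm_sq_eq]
    have h1 : ‖w‖ ^ 2 ≤ 1 := (sq_le_one_iff₀ (norm_nonneg _)).2 hw
    refine add_le_add h1 ?_
    calc ∑ i, ‖L i * ξ i / √√H‖ ^ 2 = (∑ i, ξ i ^ 2) / √H := by
          rw [Finset.sum_div]
          refine Finset.sum_congr rfl fun i _ => ?_
          rw [Real.norm_eq_abs, sq_abs, div_pow, Real.sq_sqrt (Real.sqrt_nonneg H), mul_pow, sq,
            hLL, one_mul]
      _ ≤ H / √H := by
          gcongr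
          exact hloss
      _ = √H := Real.div_sqrt
  · intro i
    -- For H = 0 the quotient is 0/0 = 0, but then all slacks vanish.
    have key : √√H / √√H * ξ i = ξ i := by
      by_cases h : √√H = 0
      · have hH0 : H = 0 := by
          rw [Real.sqrt_eq_zero (Real.sqrt_nonneg _), Real.sqrt_eq_zero hH] at h
          exact h
        have : ξ i ^ 2 ≤ 0 := by
          refine le_trans ?_ (hloss.trans hH0.le)
          exact Finset.single_le_sum (f := fun i => ξ i ^ 2) (fun j _ => sq_nonneg (ξ j))
            (Finset.mem_univ i)
        have : ξ i = 0 := by nlinarith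
        rw [this, mul_zero]
      · rw [div_self h, one_mul]
    have hin : L i * inner ℝ ((1 / √(1 + √H)) •
        (WithLp.toLp 2 (w, WithLp.toLp 2 fun i => L i * ξ i / √√H) :
          WithLp 2 (E × EuclideanSpace ℝ (Fin m)))) (extendedPoint x H i) =
        (L i * inner ℝ w (x i) + (L i * L i) * (√√H / √√H * ξ i)) / (√(1 + √H) * √(1 + √H)) := by
      rw [extendedPoint, inner_smul_left, WithLp.prod_inner_apply, e1, e2]
      simp only [inner_smul_right, conj_trivial, EuclideanSpace.inner_single_right, one_mul]
      field_simp
    rw [hin, hLL, key, one_mul, Real.mul_self_sqrt hr.le]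
    gcongr
    have : γ - L i * inner ℝ w (x i) ≤ ξ i := le_max_right _ _
    linarith

end Extended

/-! ### Random projection of a separated family -/

/-- The projected points for the signs `τ`. -/
noncomputable def projectedPoint {m n k : ℕ} (z : Fin m → Fin n → ℝ) (τ : Fin k → Fin n → Bool)
    (i : Fin m) : EuclideanSpace ℝ (Fin k) :=
  WithLp.toLp 2 fun j => signedSum (z i) (τ j) * √(1 / (k * (5 / 4)))

/-- The signs `τ` overestimate the inner product of `a` and `b` by at least `ε`. -/
def Overestimates {n k : ℕ} (a b : Fin n → ℝ) (ε : ℝ) (τ : Fin k → Fin n → Bool) : Prop :=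
  k * ε ≤ ∑ j, (signedSum a (τ j) * signedSum b (τ j) - ∑ i, a i * b i)

/-- The factor 5/4 in the scaling makes room for the error: the unscaled squared norm is at most k(1
+ 1/4). -/
theorem norm_toLp_signedSum_le {n k : ℕ} {a : Fin n → ℝ} (ha : ∑ i, a i ^ 2 ≤ 1)
    {ε : ℝ} (hε : ε ≤ 1 / 4) {τ : Fin k → Fin n → Bool} (h : ¬ Overestimates a a ε τ) :
    ‖(WithLp.toLp 2 fun j => signedSum a (τ j) * √(1 / (k * (5 / 4))) :
      EuclideanSpace ℝ (Fin k))‖ ≤ 1 := by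
  rw [← sq_le_one_iff₀ (norm_nonneg _), EuclideanSpace.norm_sq_eq]
  have e : ∀ j, ‖signedSum a (τ j) * √(1 / (k * (5 / 4)))‖ ^ 2 =
      signedSum a (τ j) * signedSum a (τ j) * (1 / (k * (5 / 4))) := by
    intro j
    rw [Real.norm_eq_abs, sq_abs, mul_pow, Real.sq_sqrt (by positivity), sq]
  simp only [e]
  rw [← Finset.sum_mul, mul_one_div]
  rw [Overestimates, not_le, Finset.sum_sub_distrib, Finset.sum_const, Finset.card_univ,
    Fintype.card_fin, nsmul_eq_mul] at h
  simp only [← sq (a _)] at h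
  refine div_le_one_of_le₀ ?_ (by positivity)
  have hk : (0 : ℝ) ≤ k := Nat.cast_nonneg k
  have := mul_le_mul_of_nonneg_left ha hk
  have := mul_le_mul_of_nonneg_left hε hk
  linarith

/-- The projection of `u` is the normal vector. Using -L_i u in place of u turns the required lower
bound into an upper one, so one-sided tails are enough. The resulting margin is (η - η/4)/(5/4) =
3η/5. -/
theorem separable_projectedPoint {m n k : ℕ} {z : Fin m → Fin n → ℝ} {u : Fin n → ℝ}
    {L : Fin m → ℝ} (hu : ∑ p, u p ^ 2 ≤ 1) (hk : 0 < k) {η : ℝ} (h0 : 0 < η) (h1 : η ≤ 1)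
    (hη : ∀ i, η ≤ L i * ∑ p, u p * z i p) {τ : Fin k → Fin n → Bool}
    (hb : ∀ i, ¬ Overestimates (fun p => -L i * u p) (z i) (η / 4) τ)
    (hb' : ¬ Overestimates u u (η / 4) τ) :
    SeparableWithMargin (projectedPoint z τ) L (η / 2) := by
  refine ⟨WithLp.toLp 2 fun j => signedSum u (τ j) * √(1 / (k * (5 / 4))),
    norm_toLp_signedSum_le hu (by linarith) hb', fun i => ?_⟩
  have hk' : (0 : ℝ) < k := Nat.cast_pos.2 hk
  have e1 : ∀ j, signedSum (fun p => -L i * u p) (τ j) = -L i * signedSum u (τ j) := by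
    intro j
    simp only [signedSum, Finset.mul_sum]
    exact Finset.sum_congr rfl fun p _ => by ring
  have e2 : ∑ p, -L i * u p * z i p = -(L i * ∑ p, u p * z i p) := by
    rw [Finset.mul_sum, ← Finset.sum_neg_distrib]
    exact Finset.sum_congr rfl fun p _ => by ring
  have h := hb i
  rw [Overestimates, not_le, e2] at h
  simp only [e1] at h
  rw [Finset.sum_sub_distrib, Finset.sum_const, Finset.card_univ, Fintype.card_fin,
    nsmul_eq_mul] at h
  have e3 : ∑ j, -L i * signedSum u (τ j) * signedSum (z i) (τ j) =
      -(L i * ∑ j, signedSum u (τ j) * signedSum (z i) (τ j)) := by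
    rw [Finset.mul_sum, ← Finset.sum_neg_distrib]
    exact Finset.sum_congr rfl fun p _ => by ring
  rw [e3] at h
  have e4 : inner ℝ (WithLp.toLp 2 fun j => signedSum u (τ j) * √(1 / (k * (5 / 4))) :
      EuclideanSpace ℝ (Fin k)) (projectedPoint z τ i) =
      (∑ j, signedSum u (τ j) * signedSum (z i) (τ j)) / (k * (5 / 4)) := by
    have hs : √(1 / ((k : ℝ) * (5 / 4))) * √(1 / (k * (5 / 4))) = 1 / (k * (5 / 4)) :=
      Real.mul_self_sqrt (by positivity)
    have e5 : ∀ a : ℝ, a / (k * (5 / 4)) =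
        a * (√(1 / ((k : ℝ) * (5 / 4))) * √(1 / (k * (5 / 4)))) := by
      intro a
      rw [hs, mul_one_div]
    rw [projectedPoint, PiLp.inner_apply, e5 (∑ j, _ * _), Finset.sum_mul]
    refine Finset.sum_congr rfl fun j _ => ?_
    simp only [RCLike.inner_apply, conj_trivial]
    ring
  rw [e4, ← mul_div_assoc, le_div_iff₀ (by positivity)]
  have := mul_le_mul_of_nonneg_left (hη i) hk'.le
  nlinarith [mul_pos hk' h0]

theorem card_overestimates_le {n k : ℕ} {a b : Fin n → ℝ} (ha : ∑ i, a i ^ 2 ≤ 1)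
    (hb : ∑ i, b i ^ 2 ≤ 1) {η : ℝ} (h0 : 0 ≤ η) (h1 : η ≤ 1)
    [DecidablePred (Overestimates (k := k) a b (η / 4))] :
    ((Finset.univ.filter (Overestimates (k := k) a b (η / 4))).card : ℝ) ≤
      (2 ^ n) ^ k * Real.exp (-(k * η ^ 2 / 32768)) := by
  have h := card_deviation_le (k := k) ha hb (ε := η / 4) (by linarith) (by linarith)
  have e : k * (η / 4) ^ 2 / 2048 = k * η ^ 2 / 32768 := by ring
  rw [e] at h
  refine le_trans (le_of_eq ?_) h
  congr 2
  ext τ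
  simp [Overestimates]

/-- The random projection preserves the margin with high probability. -/
theorem coins_projectedPoint {m n k : ℕ} (hm : 1 ≤ m) {z : Fin m → Fin n → ℝ} {u : Fin n → ℝ}
    {L : Fin m → ℝ} (hL : ∀ i, L i = 1 ∨ L i = -1)
    (hz : ∀ i, ∑ p, z i p ^ 2 ≤ 1) (hu : ∑ p, u p ^ 2 ≤ 1) {η δ : ℝ} (h0 : 0 < η) (h1 : η ≤ 1)
    (hδ : 0 < δ) (hδ1 : δ < 1) (hη : ∀ i, η ≤ L i * ∑ p, u p * z i p)
    (hk : 32768 * Real.log (3 * m / δ) ≤ k * η ^ 2) :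
    ENNReal.ofReal (1 - δ) ≤ coins {ω | (∀ i, ‖projectedPoint z (coinMatrix n k ω) i‖ ≤ 1) ∧
      SeparableWithMargin (projectedPoint z (coinMatrix n k ω)) L (η / 2)} := by
  classical
  have hm' : (1 : ℝ) ≤ m := Nat.one_le_cast.2 hm
  have hmδ : 1 < 3 * m / δ := by
    rw [lt_div_iff₀ hδ]
    linarith
  have hk0 : 0 < k := by
    rcases Nat.eq_zero_or_pos k with h | h
    · have := Real.log_pos hmδ
      rw [h, Nat.cast_zero, zero_mul] at hk
      linarith
    · exact h
  -- The bad events: loss of margin at point i, too large a norm of point i, and too large a norm of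
  -- the normal vector. These are 2m + 1 ≤ 3m events, each of probability at most δ/(3m).
  let B₁ : Fin m → Finset (Fin k → Fin n → Bool) := fun i =>
    Finset.univ.filter (Overestimates (fun p => -L i * u p) (z i) (η / 4))
  let B₂ : Fin m → Finset (Fin k → Fin n → Bool) := fun i =>
    Finset.univ.filter (Overestimates (z i) (z i) (η / 4))
  let B₃ : Finset (Fin k → Fin n → Bool) := Finset.univ.filter (Overestimates u u (η / 4))
  let S := Finset.univ.biUnion B₁ ∪ Finset.univ.biUnion B₂ ∪ B₃
  set e := Real.exp (-(k * η ^ 2 / 32768)) with he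
  have he' : e ≤ δ / (3 * m) := by
    rw [he, ← Real.le_log_iff_exp_le (by positivity), ← inv_div (3 * (m : ℝ)) δ, Real.log_inv, neg_le_neg_iff]
    linarith
  have hLu : ∀ i, ∑ p, (-L i * u p) ^ 2 ≤ 1 := by
    intro i
    have : ∀ p, (-L i * u p) ^ 2 = u p ^ 2 := by
      intro p
      rcases hL i with h | h <;> rw [h] <;> ring
    simpa only [this] using hu
  have hS : (S.card : ℝ) ≤ (2 ^ n) ^ k * δ := by
    have c1 : ((Finset.univ.biUnion B₁).card : ℝ) ≤ m * ((2 ^ n) ^ k * e) := by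
      refine (Nat.cast_le.2 Finset.card_biUnion_le).trans ?_
      rw [Nat.cast_sum]
      refine (Finset.sum_le_sum fun i _ =>
        card_overestimates_le (hLu i) (hz i) h0.le h1).trans (le_of_eq ?_)
      simp [he]
    have c2 : ((Finset.univ.biUnion B₂).card : ℝ) ≤ m * ((2 ^ n) ^ k * e) := by
      refine (Nat.cast_le.2 Finset.card_biUnion_le).trans ?_
      rw [Nat.cast_sum]
      refine (Finset.sum_le_sum fun i _ =>
        card_overestimates_le (hz i) (hz i) h0.le h1).trans (le_of_eq ?_)
      simp [he]
    have c3 : (B₃.card : ℝ) ≤ (2 ^ n) ^ k * e := card_overestimates_le hu hu h0.le h1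
    have c4 : (S.card : ℝ) ≤ (Finset.univ.biUnion B₁).card + (Finset.univ.biUnion B₂).card +
        B₃.card := by
      have := (Finset.card_union_le (Finset.univ.biUnion B₁ ∪ Finset.univ.biUnion B₂) B₃).trans
        (add_le_add_left (Finset.card_union_le _ _) _)
      exact_mod_cast this
    have he0 : 0 < e := Real.exp_pos _
    have hp : (0 : ℝ) < (2 ^ n) ^ k := by positivity
    calc (S.card : ℝ) ≤ m * ((2 ^ n) ^ k * e) + m * ((2 ^ n) ^ k * e) + (2 ^ n) ^ k * e := by
          linarith
      _ ≤ (2 ^ n) ^ k * (3 * m * e) := by nlinarith [mul_pos hp he0]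
      _ ≤ (2 ^ n) ^ k * (3 * m * (δ / (3 * m))) := by gcongr
      _ = (2 ^ n) ^ k * δ := by field_simp
  have hbad : coins {ω | coinMatrix n k ω ∈ S} ≤ ENNReal.ofReal δ := by
    refine (coins_coinMatrix_le S).trans (ENNReal.ofReal_le_ofReal ?_)
    rw [div_le_iff₀ (by positivity), mul_comm]
    exact hS
  have hsub : {ω | coinMatrix n k ω ∈ S}ᶜ ⊆ {ω |
      (∀ i, ‖projectedPoint z (coinMatrix n k ω) i‖ ≤ 1) ∧
      SeparableWithMargin (projectedPoint z (coinMatrix n k ω)) L (η / 2)} := by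
    intro ω hω
    have hω' : coinMatrix n k ω ∉ S := hω
    simp only [S, B₁, B₂, B₃, Finset.mem_union, Finset.mem_biUnion, Finset.mem_filter,
      Finset.mem_univ, true_and, not_or, not_exists] at hω'
    exact ⟨fun i => norm_toLp_signedSum_le (hz i) (by linarith) (hω'.1.2 i),
      separable_projectedPoint hu hk0 h0 h1 hη hω'.1.1 hω'.2⟩
  refine le_trans ?_ (measure_mono hsub)
  have hms : MeasurableSet {ω | coinMatrix n k ω ∈ S} := measurableSet_coinMatrix {τ | τ ∈ S}
  rw [prob_compl_eq_one_sub hms,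
    ENNReal.ofReal_sub _ hδ.le, ENNReal.ofReal_one]
  exact tsub_le_tsub_left hbad _

/-! ### The dimension and the running time -/

section Bounds

variable {m : ℕ} {γ H δ : ℝ}

/-- As m ≥ 2, the binary logarithm is at least 1, so rounding up at most doubles it, and 2/log 2 <
3. -/
theorem log_le_ceil_logb (hm : 1 < m) (hδ : 0 < δ) (hδ1 : δ < 1) :
    Real.log (m / δ) ≤ ⌈Real.logb 2 (m / δ)⌉₊ ∧
      (⌈Real.logb 2 (m / δ)⌉₊ : ℝ) ≤ 3 * Real.log (m / δ) ∧ Real.log 2 ≤ Real.log (m / δ) := by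
  have hm' : (2 : ℝ) ≤ m := by exact_mod_cast hm
  have h2 : 2 ≤ m / δ := by
    rw [le_div_iff₀ hδ]
    linarith
  have hl2 := Real.log_two_gt_d9
  have hl2' := Real.log_two_lt_d9
  have hl : Real.log 2 ≤ Real.log (m / δ) := Real.log_le_log two_pos h2
  have e : Real.logb 2 (m / δ) * Real.log 2 = Real.log (m / δ) := by
    rw [Real.logb, div_mul_cancel₀ _ (by linarith)]
  have hb : 1 ≤ Real.logb 2 (m / δ) := by
    rw [Real.logb, le_div_iff₀ (by linarith), one_mul]
    exact hl
  refine ⟨le_trans ?_ (Nat.le_ceil _), ?_, hl⟩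
  · nlinarith
  · have := Nat.ceil_lt_add_one (a := Real.logb 2 (m / δ)) (by linarith)
    nlinarith

theorem projectionDim_le (hm : 1 < m) (hH : 0 ≤ H) (hδ : 0 < δ) (hδ1 : δ < 1) :
    projectionDim m γ H δ ≤ ⌈600000 * ((H + 1) * Real.log (m / δ) / γ ^ 2)⌉₊ := by
  refine Nat.ceil_mono ?_
  rw [← mul_div_assoc]
  refine div_le_div_of_nonneg_right ?_ (sq_nonneg _)
  have := mul_le_mul_of_nonneg_left (log_le_ceil_logb hm hδ hδ1).2.1
    (show 0 ≤ 200000 * (H + 1) by positivity)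
  linarith

theorem le_projectionDim_mul_sq (hm : 1 < m) (hγ : 0 < γ) (hH : 0 ≤ H) (hδ : 0 < δ)
    (hδ1 : δ < 1) :
    32768 * Real.log (3 * m / δ) ≤ projectionDim m γ H δ * (γ / (1 + √H)) ^ 2 := by
  obtain ⟨h1, -, h3⟩ := log_le_ceil_logb hm hδ hδ1
  have hm' : (2 : ℝ) ≤ m := by exact_mod_cast hm
  have hl2 := Real.log_two_gt_d9
  have e : Real.log (3 * m / δ) = Real.log 3 + Real.log (m / δ) := by
    rw [mul_div_assoc, Real.log_mul (by norm_num) (by positivity)]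
  have h4 : Real.log 3 ≤ 2 * Real.log 2 := by
    rw [← Real.log_rpow two_pos]
    refine Real.log_le_log (by norm_num) ?_
    norm_num
  set M := Real.log (m / δ)
  have hr : 0 < 1 + √H := by positivity
  have hsq : (1 + √H) ^ 2 ≤ 2 * (H + 1) := by
    nlinarith [Real.sq_sqrt hH, sq_nonneg (√H - 1)]
  -- From log 3 ≤ 2 log 2 ≤ 2M the left side is at most 98304 M. The further factor 2 in 200000
  -- comes from (1+√H)² ≤ 2(H+1).
  calc 32768 * Real.log (3 * m / δ) ≤ 100000 * M := by rw [e]; linarith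
    _ ≤ 200000 * (H + 1) * M / (1 + √H) ^ 2 := by
        rw [le_div_iff₀ (by positivity)]
        nlinarith [mul_le_mul_of_nonneg_left hsq (show 0 ≤ M by linarith)]
    _ = 200000 * (H + 1) * M / γ ^ 2 * (γ / (1 + √H)) ^ 2 := by field_simp
    _ ≤ 200000 * (H + 1) * ⌈Real.logb 2 (m / δ)⌉₊ / γ ^ 2 * (γ / (1 + √H)) ^ 2 := by gcongr
    _ ≤ _ := by
        gcongr
        exact Nat.le_ceil _

/-- The running time in terms of `m`, `n`, `1 / γ` and `log (1 / δ)`. -/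
def timeBound (m n g r : ℝ) : ℝ :=
  200 * ((m + 1) ^ 3 * (n + 1) * (200000 * (m + g ^ 2) * (3 * (m + r)) + 2) * (3 * (m + r) + 1))

theorem time_le_timeBound (n : ℕ) (hm : 1 < m) (hγ : 0 < γ) (hH : 0 ≤ H) (hδ : 0 < δ)
    (hδ1 : δ < 1) (hc : H < m * γ ^ 2) :
    ((200 * ((m + 1) ^ 3 * (n + 1) * (projectionDim m γ H δ + 1) *
      (⌈Real.logb 2 (m / δ)⌉₊ + 1)) : ℕ) : ℝ) ≤ timeBound m n (1 / γ) (Real.log (1 / δ)) := by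
  obtain ⟨h1, h2, h3⟩ := log_le_ceil_logb hm hδ hδ1
  have hm' : (2 : ℝ) ≤ m := by exact_mod_cast hm
  have hl2 := Real.log_two_gt_d9
  have hr : 0 < Real.log (1 / δ) := Real.log_pos (by rw [lt_div_iff₀ hδ]; linarith)
  have e : Real.log (m / δ) = Real.log m + Real.log (1 / δ) := by
    rw [← Real.log_mul (by positivity) (by positivity), mul_one_div]
  have hlm : Real.log m ≤ m := (Real.log_le_sub_one_of_pos (by positivity)).trans (by linarith)
  have hl : (⌈Real.logb 2 (m / δ)⌉₊ : ℝ) ≤ 3 * (m + Real.log (1 / δ)) := by linarith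
  -- Here H < mγ² removes H from the running time.
  have hHγ : (H + 1) / γ ^ 2 ≤ m + (1 / γ) ^ 2 := by
    rw [add_div, one_div_pow]
    gcongr
    rw [div_le_iff₀ (by positivity)]
    exact hc.le
  have hk : (projectionDim m γ H δ : ℝ) ≤
      200000 * (m + (1 / γ) ^ 2) * (3 * (m + Real.log (1 / δ))) + 1 := by
    refine (Nat.ceil_lt_add_one (by positivity)).le.trans ?_
    gcongr
    calc _ = 200000 * ((H + 1) / γ ^ 2) * ⌈Real.logb 2 (m / δ)⌉₊ := by ring
      _ ≤ _ := by gcongr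
  push_cast
  rw [timeBound]
  exact mul_le_mul_of_nonneg_left (mul_le_mul (mul_le_mul_of_nonneg_left (by linarith)
    (by positivity)) (by linarith) (by positivity) (by positivity)) (by norm_num)

theorem time_le_timeBound' (n : ℕ) (g : ℝ) (hδ : 0 < δ) (hδ1 : δ < 1) :
    ((200 * (m + 1) ^ 3 : ℕ) : ℝ) ≤ timeBound m n g (Real.log (1 / δ)) := by
  have hr : 0 < Real.log (1 / δ) := Real.log_pos (by rw [lt_div_iff₀ hδ]; linarith)
  set r := Real.log (1 / δ)
  push_cast
  rw [timeBound, mul_assoc ((m + 1 : ℝ) ^ 3), mul_assoc ((m + 1 : ℝ) ^ 3)]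
  gcongr
  refine le_mul_of_one_le_right (by positivity) ?_
  have hm0 : (0 : ℝ) ≤ m := Nat.cast_nonneg m
  have hn0 : (0 : ℝ) ≤ n := Nat.cast_nonneg n
  have h1 : (1 : ℝ) ≤ n + 1 := by linarith
  have h2 : 1 ≤ 200000 * (m + g ^ 2) * (3 * (m + r)) + 2 := by
    have : 0 ≤ 200000 * (m + g ^ 2) * (3 * (m + r)) := by positivity
    linarith
  have h3 : 1 ≤ 3 * (m + r) + 1 := by
    have : 0 ≤ 3 * (m + r) := by positivity
    linarith
  exact one_le_mul_of_one_le_of_one_le (one_le_mul_of_one_le_of_one_le h1 h2) h3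

end Bounds

/-! ### Correctness of the preprocessing -/

section Main

variable {E : Type*} [NormedAddCommGroup E] [InnerProductSpace ℝ E] {m n : ℕ} {γ H δ : ℝ}

/-- Applied to the extended points, this supplies the condition η ≤ 1 of the tail bound and settles
the margin in the case m = 1. -/
theorem margin_le_one (hm : 1 ≤ m) {x : Fin m → E} (hx : ∀ i, ‖x i‖ ≤ 1) {L : Fin m → ℝ}
    (hL : ∀ i, L i = 1 ∨ L i = -1) {η : ℝ} (h : SeparableWithMargin x L η) : η ≤ 1 := by
  obtain ⟨w, hw, h⟩ := h
  let i : Fin m := ⟨0, hm⟩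
  refine (h i).trans ((le_abs_self _).trans ?_)
  have hLi : |L i| = 1 := by rcases hL i with h | h <;> simp [h]
  rw [abs_mul, hLi, one_mul]
  exact (abs_real_inner_le_norm _ _).trans (mul_le_one₀ hw (norm_nonneg _) (hx i))

theorem separable_single (hm : 1 ≤ m) {L : Fin m → ℝ} (hL : ∀ i, L i = 1 ∨ L i = -1)
    {η : ℝ} (hη : η ≤ 1 / √m) :
    SeparableWithMargin (fun i : Fin m => EuclideanSpace.single i (1 : ℝ)) L η := by
  have hm' : (0 : ℝ) < m := by exact_mod_cast hm
  have hLL : ∀ i, L i * L i = 1 := by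
    intro i
    rcases hL i with h | h <;> rw [h] <;> norm_num
  refine ⟨(1 / √m) • WithLp.toLp 2 L, ?_, fun i => ?_⟩
  · rw [norm_smul, Real.norm_of_nonneg (by positivity), EuclideanSpace.norm_eq]
    have : ∀ i, ‖L i‖ ^ 2 = 1 := by
      intro i
      rw [Real.norm_eq_abs, sq_abs, sq, hLL]
    simp only [this]
    rw [Finset.sum_const, Finset.card_univ, Fintype.card_fin, nsmul_eq_mul, mul_one,
      one_div_mul_cancel (Real.sqrt_pos.2 hm').ne']
  · rw [inner_smul_left, EuclideanSpace.inner_single_right]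
    simp only [conj_trivial, one_mul]
    rw [mul_left_comm, hLL, mul_one]
    exact hη

/-- The rows of the Cholesky decomposition of the kernel matrix of the extended points. -/
noncomputable def choleskyRow (x : Fin m → E) (H : ℝ) (i p : Fin m) : ℝ :=
  column (extendedKernel (ofArray fun i j : Fin m => inner ℝ (x i) (x j)) H) p i

theorem sum_choleskyRow_mul (x : Fin m → E) (H : ℝ) (i j : Fin m) :
    ∑ p, choleskyRow x H i p * choleskyRow x H j p =
      inner ℝ (extendedPoint x H i) (extendedPoint x H j) := by
  have h := sum_column_mul_column (m := m)
    (A := extendedKernel (ofArray fun i j : Fin m => inner ℝ (x i) (x j)) H)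
    (fun u => if h : u < m then extendedPoint x H ⟨u, h⟩ else 0) (fun u v hu hv => by
      simp only [dif_pos hu, dif_pos hv, inner_extendedPoint, extendedKernel, ofArray,
        dif_pos (And.intro hu hv), Fin.mk.injEq]) i.2 j.2
  simp only [Fin.is_lt, dite_true, Fin.eta] at h
  rw [← h, Finset.sum_range]
  rfl

theorem preprocesses_of_isInput (hm : 1 ≤ m) {x : Fin m → E} (hx : ∀ i, ‖x i‖ ≤ 1)
    (hγ : 0 < γ) (hH : 0 ≤ H) (hδ : 0 < δ) (hδ1 : δ < 1) {input : State}
    (hs : IsInput input m n (ofArray fun i j : Fin m => inner ℝ (x i) (x j)) γ H δ) :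
    Preprocesses preprocessing input (timeBound m n (1 / γ) (Real.log (1 / δ))) 600000
      x γ H δ := by
  have hη : γ / (2 + 2 * √H) = γ / (1 + √H) / 2 := by
    rw [div_div]
    congr 1
    ring
  by_cases hc : 1 < m ∧ H < m * γ ^ 2
  · set k := projectionDim m γ H δ with hk
    refine ⟨k, fun ω => projectedPoint (choleskyRow x H) (coinMatrix m k ω),
      projectionDim_le hc.1 hH hδ hδ1, fun ω => ?_, fun L hL ⟨w, hw, hloss⟩ => ?_⟩
    · obtain ⟨s, t, h1, h2, h3, h4⟩ := reaches_preprocessing (ω := ω) hs hγ hδ hc rfl hk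
      refine ⟨s, t, h1, (Nat.cast_le.2 h2).trans
        (time_le_timeBound n hc.1 hγ hH hδ hδ1 hc.2), h3, fun i j => ?_⟩
      rw [h4 i j i.2 j.2, Finset.sum_range]
      simp only [projectedPoint, signedSum, choleskyRow, coinMatrix, mul_comm]
    · have hsep := separable_extendedPoint hL hH hw hloss
      have hle := margin_le_one hm (norm_extendedPoint_le hx H) hL hsep
      obtain ⟨u, hu, hsep⟩ := hsep
      -- The separating vector of the extended points lives in E × ℝ^m; it is moved to ℝ^m, where
      -- the Cholesky rows are.
      obtain ⟨u', hu', hinner⟩ := exists_inner_eq_of_gram_eq (x := extendedPoint x H)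
        (z := fun i => (WithLp.toLp 2 (choleskyRow x H i) : EuclideanSpace ℝ (Fin m)))
        (fun i j => by
          rw [← sum_choleskyRow_mul, PiLp.inner_apply]
          simp [mul_comm]) u
      rw [hη]
      refine coins_projectedPoint hm (u := fun p => u' p) hL (fun i => ?_) ?_ (by positivity)
        hle hδ hδ1 (fun i => ?_) (le_projectionDim_mul_sq hc.1 hγ hH hδ hδ1)
      · simp only [sq]
        rw [sum_choleskyRow_mul, real_inner_self_eq_norm_sq]
        exact (sq_le_one_iff₀ (norm_nonneg _)).2 (norm_extendedPoint_le hx H i)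
      · have := (sq_le_one_iff₀ (norm_nonneg _)).2 (hu'.trans hu)
        rw [EuclideanSpace.norm_sq_eq] at this
        simpa using this
      · refine (hsep i).trans (le_of_eq ?_)
        rw [← hinner i, PiLp.inner_apply]
        simp [mul_comm]
  · have hm' : (1 : ℝ) ≤ m := Nat.one_le_cast.2 hm
    have hlog : 0 < Real.log (m / δ) := Real.log_pos (by rw [lt_div_iff₀ hδ]; linarith)
    refine ⟨m, fun _ i => EuclideanSpace.single i 1, ?_, fun ω => ?_,
      fun L hL ⟨w, hw, hloss⟩ => ?_⟩
    -- For m = 1 it suffices that the bound is positive before rounding up. Otherwise m ≤ H/γ², and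
    -- 600000 log(m/δ) ≥ 600000 log 2 exceeds 1.
    · rcases hm.eq_or_lt with h | h
      · rw [← h, Nat.one_le_ceil_iff, h]
        positivity
      · have hle : m * γ ^ 2 ≤ H := not_lt.1 fun h' => hc ⟨h, h'⟩
        rw [← Nat.cast_le (α := ℝ)]
        refine le_trans ?_ (Nat.le_ceil _)
        have hl := (log_le_ceil_logb h hδ hδ1).2.2
        have hl2 := Real.log_two_gt_d9
        rw [← mul_div_assoc, le_div_iff₀ (by positivity)]
        nlinarith
    · obtain ⟨s, t, h1, h2, h3, h4⟩ := reaches_preprocessing_of_not (ω := ω) hs hc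
      refine ⟨s, t, h1, (Nat.cast_le.2 h2).trans (time_le_timeBound' n _ hδ hδ1), h3,
        fun i j => ?_⟩
      rw [h4 i j i.2 j.2, PiLp.single_apply]
      simp only [Fin.ext_iff, eq_comm]
    · have hall : ∀ ω : ℕ → Bool, ω ∈ {ω : ℕ → Bool |
          (∀ i : Fin m, ‖(EuclideanSpace.single i 1 : EuclideanSpace ℝ (Fin m))‖ ≤ 1) ∧
          SeparableWithMargin (fun i : Fin m => EuclideanSpace.single i (1 : ℝ)) L
            (γ / (2 + 2 * √H))} := by
        intro ω
        refine ⟨fun i => by simp, separable_single hm hL ?_⟩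
        rcases hm.eq_or_lt with h | h
        · have hle := margin_le_one hm (norm_extendedPoint_le hx H) hL
            (separable_extendedPoint hL hH hw hloss)
          rw [hη, ← h, Nat.cast_one, Real.sqrt_one]
          linarith
        · have hle : m * γ ^ 2 ≤ H := not_lt.1 fun h' => hc ⟨h, h'⟩
          -- This gives γ/(2+2√H) ≤ 1/√m, the margin of the standard basis.
          have h' : √m * γ ≤ √H := by
            refine Real.le_sqrt_of_sq_le ?_
            rwa [mul_pow, Real.sq_sqrt (Nat.cast_nonneg m)]
          rw [div_le_div_iff₀ (by positivity) (Real.sqrt_pos.2 (by linarith))]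
          linarith [Real.sqrt_nonneg H]
      rw [Set.eq_univ_of_forall hall, measure_univ]
      exact ENNReal.ofReal_le_one.2 (by linarith)

end Main

end RealRAM

/-! ### The main theorem -/

theorem mainTheorem9 :
    ∃ (P : RealRAM.Program) (C : ℝ) (p : MvPolynomial (Fin 4) ℝ) (q : MvPolynomial (Fin 3) ℝ),
      0 < C ∧
      (∀ (m d : ℕ) (x : Fin m → EuclideanSpace ℝ (Fin d)) (γ H δ : ℝ),
        1 ≤ m → (∀ i, ‖x i‖ ≤ 1) → 0 < γ → 0 ≤ H → 0 < δ → δ < 1 →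
        Preprocesses P (RealRAM.vectorInput x γ H δ)
          (MvPolynomial.eval ![(d : ℝ), (m : ℝ), 1 / γ, Real.log (1 / δ)] p) C x γ H δ) ∧
      (∀ (E : Type*) [NormedAddCommGroup E] [InnerProductSpace ℝ E] [CompleteSpace E]
        (m : ℕ) (x : Fin m → E) (γ H δ : ℝ),
        1 ≤ m → (∀ i, ‖x i‖ ≤ 1) → 0 < γ → 0 ≤ H → 0 < δ → δ < 1 →
        Preprocesses P (RealRAM.kernelInput (Matrix.of fun i j => inner ℝ (x i) (x j)) γ H δ)
          (MvPolynomial.eval ![(m : ℝ), 1 / γ, Real.log (1 / δ)] q) C x γ H δ) := by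
  -- Both polynomials are `timeBound`, with row length d for vectors and row length m for a kernel
  -- matrix.
  open MvPolynomial in
  refine ⟨RealRAM.preprocessing, 600000,
    C 200 * ((X 1 + 1) ^ 3 * (X 0 + 1) * (C 200000 * (X 1 + X 2 ^ 2) * (C 3 * (X 1 + X 3)) + C 2) *
      (C 3 * (X 1 + X 3) + 1)),
    C 200 * ((X 0 + 1) ^ 3 * (X 0 + 1) * (C 200000 * (X 0 + X 1 ^ 2) * (C 3 * (X 0 + X 2)) + C 2) *
      (C 3 * (X 0 + X 2) + 1)), by norm_num, ?_, ?_⟩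
  · intro m d x γ H δ hm hx hγ hH hδ hδ1
    have h := RealRAM.preprocesses_of_isInput hm hx hγ hH hδ hδ1
      (RealRAM.isInput_vectorInput x γ H δ)
    simpa [RealRAM.timeBound] using h
  · intro E _ _ _ m x γ H δ hm hx hγ hH hδ hδ1
    have h := RealRAM.preprocesses_of_isInput hm hx hγ hH hδ hδ1
      (RealRAM.isInput_kernelInput (Matrix.of fun i j => inner ℝ (x i) (x j)) γ H δ)
    simpa [RealRAM.timeBound] using h
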